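/- Let $d\in\{2,3\}$, let $\Omega\subset\mathbb R^d$ be a bounded open set with Lipschitz boundary $\Gamma=\partial\Omega$, equipped with surface measure, and let $f_1\in L^2(\Gamma)$, $f_2\in L^2(\Omega)$, $\alpha>0$, $\gamma>0$. (In the application $f_1=D\,\nabla u\cdot\vec n$ is the measured boundary current and $f_2=\tilde Q$ is the effective source.) Let $$X=H^1_{0,x}(\Omega\times\Omega)=\{G\in H^1(\Omega\times\Omega):\ G(\cdot,y)\in H^1_0(\Omega)\ \text{for a.e. } y\in\Omega\},$$ $$\|G\|_X^2=\|G\|^2_{L^2(\Omega\times\Omega)}+\|\nabla_xG\|^2_{L^2(\Omega\times\Omega)}+\|\nabla_yG\|^2_{L^2(\Omega\times\Omega)},$$ let $Y=L^2(\Omega)$, and for $G\in X$ let $$\mathcal F(G)(x)=\int_\Gamma G(x,y)f_1(y)\,dS(y)+\int_\Omega G(x,y)f_2(y)\,dy,\qquad x\in\Omega,$$ where in the first integral $G$ on $\Omega\times\Gamma$ is understood as the trace of $G$ in the variable $y$, that is, the unique $T\in L^2(\Omega\times\Gamma)$ for which there are functions $\varphi_n\in C^1(\mathbb R^d\times\mathbb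 R^d)$ with $\varphi_n\to G$ in $H^1(\Omega\times\Omega)$ and $\varphi_n|_{\Omega\times\Gamma}\to T$ in $L^2(\Omega\times\Gamma)$. For $u_{obs}\in Y$ define, with $G^T(x,y)=G(y,x)$, $$J(G;u_{obs})=\|\mathcal F(G)-u_{obs}\|_Y^2+\alpha\bigl(\|G\|_X^2+\gamma\|G-G^T\|^2_{L^2(\Omega\times\Omega)}\bigr),\qquad G\in X .$$ Then the problem of minimizing $J(\cdot\,;u_{obs})$ over $X$ is well-posed: 0. $\mathcal F$ is well defined from $X$ to $Y$: every $G\in X$ has exactly one trace on $\Omega\times\Gamma$, both integrals converge absolutely for a.e. $x\in\Omega$, and $\mathcal F(G)\in L^2(\Omega)$. 1. (Existence) For every $u_{obs}\in Y$ there is a minimizer of $J(\cdot\,;u_{obs})$ in $X$. 2. (Uniqueness) For every $u_{obs}\in Y$ any two minimizers of $J(\cdot\,;u_{obs})$ in $X$ coincide. 3. (Stability) If $u_n\to u_{obs}$ in $Y$, $G_n$ is the minimizer of $J(\cdot\,;u_n)$ and $G^*$ is the minimizer of $J(\cdot\,;u_{obs})$, then $\|G_n-G^*\|_X\to0$. 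-/

import Mathlib

open MeasureTheory Filter Topology
open scoped ContDiff InnerProductSpace

noncomputable section

namespace GreenTikhonov

/-- The Euclidean space `ℝ^d`. -/
abbrev E (d : ℕ) : Type := EuclideanSpace ℝ (Fin d)

/-- `Ω ⊆ ℝ^d` is open and bounded with Lipschitz boundary: near every boundary point `p`, after
choosing a direction `ν`, the set `Ω` is the strict region above the graph of a Lipschitz function
`g` of the coordinates orthogonal to `ν` (`g` is written as a function on `ℝ^d` that is invariant
in the direction `ν`). -/
structure IsBoundedLipschitzDomain {d : ℕ} (Ω : Set (E d)) : Prop where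
  isOpen : IsOpen Ω
  isBounded : Bornology.IsBounded Ω
  graph : ∀ p ∈ frontier Ω, ∃ (r : ℝ) (ν : E d) (K : NNReal) (g : E d → ℝ),
    0 < r ∧ ‖ν‖ = 1 ∧ LipschitzWith K g ∧ (∀ (x : E d) (t : ℝ), g (x + t • ν) = g x) ∧
    ∀ x ∈ Metric.ball p r, x ∈ Ω ↔ g x < ⟪x, ν⟫_ℝ

/-- Lebesgue measure on `Ω`. -/
abbrev vol {d : ℕ} (Ω : Set (E d)) : Measure (E d) := volume.restrict Ω

/-- Surface measure on the boundary `Γ = ∂Ω`: the `(d-1)`-dimensional Hausdorff measure with the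
Euclidean normalization, restricted to `∂Ω`. -/
abbrev surf {d : ℕ} (Ω : Set (E d)) : Measure (E d) :=
  (Measure.euclideanHausdorffMeasure (d - 1)).restrict (frontier Ω)

/-- Lebesgue measure on `Ω × Ω`. -/
abbrev vol2 {d : ℕ} (Ω : Set (E d)) : Measure (E d × E d) := (vol Ω).prod (vol Ω)

/-- The Hilbert space of triples `(G, G₁, G₂)` with `G ∈ L²(Ω×Ω)` and `G₁, G₂ ∈ L²(Ω×Ω; ℝ^d)`,
with squared norm `‖G‖² + ‖G₁‖² + ‖G₂‖²`. -/
abbrev Triple {d : ℕ} (Ω : Set (E d)) : Type :=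
  WithLp 2 (Lp ℝ 2 (vol2 Ω) × WithLp 2 (Lp (E d) 2 (vol2 Ω) × Lp (E d) 2 (vol2 Ω)))

namespace Triple

variable {d : ℕ} {Ω : Set (E d)}

/-- The function itself. -/
abbrev val (G : Triple Ω) : Lp ℝ 2 (vol2 Ω) := G.fst

/-- The candidate for the gradient in the first variable `x`. -/
abbrev gradX (G : Triple Ω) : Lp (E d) 2 (vol2 Ω) := G.snd.fst

/-- The candidate for the gradient in the second variable `y`. -/
abbrev gradY (G : Triple Ω) : Lp (E d) 2 (vol2 Ω) := G.snd.snd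

end Triple

/-- `G.gradX` and `G.gradY` are the weak partial gradients of `G.val` on `Ω × Ω`, so that
`G.val ∈ H¹(Ω×Ω)`. -/
def IsH1 {d : ℕ} {Ω : Set (E d)} (G : Triple Ω) : Prop :=
  ∀ φ : E d × E d → ℝ, ContDiff ℝ ∞ φ → HasCompactSupport φ → tsupport φ ⊆ Ω ×ˢ Ω → ∀ v : E d,
    (∫ p, G.val p * fderiv ℝ φ p (v, 0) ∂(vol2 Ω) = -∫ p, φ p * ⟪G.gradX p, v⟫_ℝ ∂(vol2 Ω)) ∧
    (∫ p, G.val p * fderiv ℝ φ p (0, v) ∂(vol2 Ω) = -∫ p, φ p * ⟪G.gradY p, v⟫_ℝ ∂(vol2 Ω))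

/-- `u ∈ H¹₀(Ω)` with weak gradient `h`: the pair `(u, h)` is the `L²` limit of pairs `(φₙ, ∇φₙ)`
with test functions `φₙ ∈ C_c^∞(Ω)`. -/
def IsH10 {d : ℕ} (Ω : Set (E d)) (u : E d → ℝ) (h : E d → E d) : Prop :=
  MemLp u 2 (vol Ω) ∧ MemLp h 2 (vol Ω) ∧
  ∃ φ : ℕ → E d → ℝ,
    (∀ n, ContDiff ℝ ∞ (φ n) ∧ HasCompactSupport (φ n) ∧ tsupport (φ n) ⊆ Ω) ∧
    Tendsto (fun n => eLpNorm (fun x => φ n x - u x) 2 (vol Ω)) atTop (𝓝 0) ∧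
    Tendsto (fun n => eLpNorm (fun x => gradient (φ n) x - h x) 2 (vol Ω)) atTop (𝓝 0)

section Helpers

variable {d : ℕ} {Ω : Set (E d)}

theorem IsH10.congr {u u' : E d → ℝ} {h h' : E d → E d} (H : IsH10 Ω u h)
    (hu : u =ᵐ[vol Ω] u') (hh : h =ᵐ[vol Ω] h') : IsH10 Ω u' h' := by
  obtain ⟨h1, h2, φ, hφ, l1, l2⟩ := H
  refine ⟨h1.ae_eq hu, h2.ae_eq hh, φ, hφ, ?_, ?_⟩
  · refine l1.congr fun n => eLpNorm_congr_ae ?_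
    filter_upwards [hu] with x hx
    rw [hx]
  · refine l2.congr fun n => eLpNorm_congr_ae ?_
    filter_upwards [hh] with x hx
    rw [hx]

theorem IsH10.zero : IsH10 Ω (fun _ => 0) (fun _ => 0) := by
  refine ⟨MemLp.zero', MemLp.zero', fun _ _ => 0, fun n => ⟨contDiff_const, ?_, ?_⟩, ?_, ?_⟩
  · exact HasCompactSupport.zero
  · have : tsupport (fun _ : E d => (0 : ℝ)) = ∅ := by
      rw [tsupport_eq_empty_iff]
      rfl
    rw [this]
    exact Set.empty_subset _
  · simp
  · have : ∀ x : E d, gradient (fun _ : E d => (0 : ℝ)) x = 0 := fun x => by simp [gradient]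
    simp [this]

theorem gradient_combo {a b : ℝ} {φ ψ : E d → ℝ} (hφ : ContDiff ℝ ∞ φ) (hψ : ContDiff ℝ ∞ ψ)
    (x : E d) : gradient (fun x => a * φ x + b * ψ x) x = a • gradient φ x + b • gradient ψ x := by
  have h1 : DifferentiableAt ℝ φ x := (hφ.differentiable (by simp)) x
  have h2 : DifferentiableAt ℝ ψ x := (hψ.differentiable (by simp)) x
  have e : fderiv ℝ (fun x => a * φ x + b * ψ x) x = a • fderiv ℝ φ x + b • fderiv ℝ ψ x := by
    rw [fderiv_fun_add (h1.const_mul a) (h2.const_mul b), fderiv_const_mul h1, fderiv_const_mul h2]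
  simp [gradient, e]

theorem tendsto_combo {F : Type*} [NormedAddCommGroup F] [NormedSpace ℝ F] (a b : ℝ)
    {φ ψ : ℕ → E d → F} {u v : E d → F} (hφ : ∀ n, AEStronglyMeasurable (φ n) (vol Ω))
    (hψ : ∀ n, AEStronglyMeasurable (ψ n) (vol Ω)) (hu : MemLp u 2 (vol Ω))
    (hv : MemLp v 2 (vol Ω))
    (l1 : Tendsto (fun n => eLpNorm (fun x => φ n x - u x) 2 (vol Ω)) atTop (𝓝 0))
    (l2 : Tendsto (fun n => eLpNorm (fun x => ψ n x - v x) 2 (vol Ω)) atTop (𝓝 0)) :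
    Tendsto (fun n => eLpNorm (fun x => (a • φ n x + b • ψ n x) - (a • u x + b • v x)) 2 (vol Ω))
      atTop (𝓝 0) := by
  have l : Tendsto (fun n => ‖a‖ₑ * eLpNorm (fun x => φ n x - u x) 2 (vol Ω) +
      ‖b‖ₑ * eLpNorm (fun x => ψ n x - v x) 2 (vol Ω)) atTop (𝓝 0) := by
    have := (ENNReal.Tendsto.const_mul (a := ‖a‖ₑ) l1 (Or.inr (by simp))).add
      (ENNReal.Tendsto.const_mul (a := ‖b‖ₑ) l2 (Or.inr (by simp)))
    simpa using this
  refine tendsto_of_tendsto_of_tendsto_of_le_of_le tendsto_const_nhds l (fun _ => bot_le) ?_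
  intro n
  have e : (fun x => (a • φ n x + b • ψ n x) - (a • u x + b • v x)) =
      a • (fun x => φ n x - u x) + b • (fun x => ψ n x - v x) := by
    funext x
    simp only [Pi.add_apply, Pi.smul_apply, smul_sub]
    abel
  simp only [e]
  refine (eLpNorm_add_le (((hφ n).sub hu.1).const_smul a) (((hψ n).sub hv.1).const_smul b)
    (by norm_num)).trans ?_
  rw [eLpNorm_const_smul, eLpNorm_const_smul]
  exact le_rfl

theorem IsH10.combo {a b : ℝ} {u v : E d → ℝ} {h k : E d → E d} (H : IsH10 Ω u h)
    (K : IsH10 Ω v k) :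
    IsH10 Ω (fun x => a * u x + b * v x) (fun x => a • h x + b • k x) := by
  obtain ⟨h1, h2, φ, hφ, l1, l2⟩ := H
  obtain ⟨k1, k2, ψ, hψ, m1, m2⟩ := K
  refine ⟨(h1.const_mul a).add (k1.const_mul b), (h2.const_smul a).add (k2.const_smul b),
    fun n x => a * φ n x + b * ψ n x, fun n => ⟨?_, ?_, ?_⟩, ?_, ?_⟩
  · exact (contDiff_const.mul (hφ n).1).add (contDiff_const.mul (hψ n).1)
  · exact HasCompactSupport.add ((hφ n).2.1.mul_left) ((hψ n).2.1.mul_left)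
  · refine (tsupport_add _ _).trans (Set.union_subset ?_ ?_)
    · exact (tsupport_mul_subset_right (f := fun _ => a) (g := φ n)).trans (hφ n).2.2
    · exact (tsupport_mul_subset_right (f := fun _ => b) (g := ψ n)).trans (hψ n).2.2
  · exact tendsto_combo a b (fun n => (hφ n).1.continuous.aestronglyMeasurable)
      (fun n => (hψ n).1.continuous.aestronglyMeasurable) h1 k1 l1 m1
  · have c : ∀ {f : E d → ℝ}, ContDiff ℝ ∞ f → AEStronglyMeasurable (gradient f) (vol Ω) :=
      fun {f} hf => ((InnerProductSpace.toDual ℝ (E d)).symm.continuous.comp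
        (hf.continuous_fderiv (by simp))).aestronglyMeasurable
    simp only [fun n x => gradient_combo (a := a) (b := b) (hφ n).1 (hψ n).1 x]
    exact tendsto_combo a b (fun n => c (hφ n).1) (fun n => c (hψ n).1) h2 k2 l2 m2

theorem ae_slice {P : E d × E d → Prop} (h : ∀ᵐ p ∂(vol2 Ω), P p) :
    ∀ᵐ y ∂(vol Ω), ∀ᵐ x ∂(vol Ω), P (x, y) := by
  have h' : ∀ᵐ p ∂(vol2 Ω), P p.swap := by
    have e : (vol2 Ω).map Prod.swap = vol2 Ω := Measure.prod_swap
    rw [← e] at h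
    exact ae_of_ae_map measurable_swap.aemeasurable h
  exact Measure.ae_ae_of_ae_prod h'

theorem IsH1.combo {a b : ℝ} {G H : Triple Ω} (hG : IsH1 G) (hH : IsH1 H) :
    IsH1 (a • G + b • H) := by
  intro φ hφ hc hs v
  have hm : MemLp φ 2 (vol2 Ω) := hφ.continuous.memLp_of_hasCompactSupport hc
  have hd : ∀ w : E d × E d, MemLp (fun p => fderiv ℝ φ p w) 2 (vol2 Ω) := fun w =>
    ((hφ.continuous_fderiv (by simp)).clm_apply continuous_const).memLp_of_hasCompactSupport
      (hc.fderiv_apply (𝕜 := ℝ) w)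
  have iL : ∀ (f : Lp ℝ 2 (vol2 Ω)) (w : E d × E d),
      Integrable (fun p => f p * fderiv ℝ φ p w) (vol2 Ω) :=
    fun f w => (Lp.memLp f).integrable_mul (hd w)
  have iR : ∀ f : Lp (E d) 2 (vol2 Ω),
      Integrable (fun p => φ p * ⟪f p, v⟫_ℝ) (vol2 Ω) :=
    fun f => hm.integrable_mul ((Lp.memLp f).inner_const v)
  have key : ∀ (f g : Lp ℝ 2 (vol2 Ω)) (f' g' : Lp (E d) 2 (vol2 Ω)) (w : E d × E d),
      (∫ p, f p * fderiv ℝ φ p w ∂(vol2 Ω) = -∫ p, φ p * ⟪f' p, v⟫_ℝ ∂(vol2 Ω)) →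
      (∫ p, g p * fderiv ℝ φ p w ∂(vol2 Ω) = -∫ p, φ p * ⟪g' p, v⟫_ℝ ∂(vol2 Ω)) →
      ∫ p, (a • f + b • g : Lp ℝ 2 (vol2 Ω)) p * fderiv ℝ φ p w ∂(vol2 Ω) =
        -∫ p, φ p * ⟪(a • f' + b • g' : Lp (E d) 2 (vol2 Ω)) p, v⟫_ℝ ∂(vol2 Ω) := by
    intro f g f' g' w h1 h2
    have e1 : ∫ p, (a • f + b • g : Lp ℝ 2 (vol2 Ω)) p * fderiv ℝ φ p w ∂(vol2 Ω) =
        ∫ p, (a * (f p * fderiv ℝ φ p w) + b * (g p * fderiv ℝ φ p w)) ∂(vol2 Ω) := by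
      refine integral_congr_ae ?_
      filter_upwards [Lp.coeFn_add (a • f) (b • g), Lp.coeFn_smul a f, Lp.coeFn_smul b g]
        with p q1 q2 q3
      rw [q1, Pi.add_apply, q2, q3]
      simp only [Pi.smul_apply, smul_eq_mul]
      ring
    have e2 : ∫ p, φ p * ⟪(a • f' + b • g' : Lp (E d) 2 (vol2 Ω)) p, v⟫_ℝ ∂(vol2 Ω) =
        ∫ p, (a * (φ p * ⟪f' p, v⟫_ℝ) + b * (φ p * ⟪g' p, v⟫_ℝ)) ∂(vol2 Ω) := by
      refine integral_congr_ae ?_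
      filter_upwards [Lp.coeFn_add (a • f') (b • g'), Lp.coeFn_smul a f', Lp.coeFn_smul b g']
        with p q1 q2 q3
      rw [q1, Pi.add_apply, q2, q3]
      simp only [Pi.smul_apply, inner_add_left, real_inner_smul_left]
      ring
    rw [e1, e2, integral_add ((iL f w).const_mul a) ((iL g w).const_mul b),
      integral_add ((iR f').const_mul a) ((iR g').const_mul b), integral_const_mul,
      integral_const_mul, integral_const_mul, integral_const_mul, h1, h2]
    ring
  exact ⟨key _ _ _ _ _ (hG φ hφ hc hs v).1 (hH φ hφ hc hs v).1,
    key _ _ _ _ _ (hG φ hφ hc hs v).2 (hH φ hφ hc hs v).2⟩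

end Helpers

/-- The property defining `H¹_{0,x}(Ω×Ω)`: `G ∈ H¹(Ω×Ω)`, and for almost every `y ∈ Ω` the slice
`G(·, y)`, whose gradient is `∇ₓG(·, y)`, lies in `H¹₀(Ω)`. -/
def MemX {d : ℕ} {Ω : Set (E d)} (G : Triple Ω) : Prop :=
  IsH1 G ∧ ∀ᵐ y ∂(vol Ω), IsH10 Ω (fun x => G.val (x, y)) (fun x => G.gradX (x, y))

theorem MemX.combo {d : ℕ} {Ω : Set (E d)} {a b : ℝ} {G H : Triple Ω} (hG : MemX G)
    (hH : MemX H) : MemX (a • G + b • H) := by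
  refine ⟨hG.1.combo hH.1, ?_⟩
  have s1 := ae_slice (Lp.coeFn_add (a • G.val) (b • H.val))
  have s2 := ae_slice (Lp.coeFn_smul a G.val)
  have s3 := ae_slice (Lp.coeFn_smul b H.val)
  have t1 := ae_slice (Lp.coeFn_add (a • G.gradX) (b • H.gradX))
  have t2 := ae_slice (Lp.coeFn_smul a G.gradX)
  have t3 := ae_slice (Lp.coeFn_smul b H.gradX)
  filter_upwards [hG.2, hH.2, s1, s2, s3, t1, t2, t3] with y g h s1 s2 s3 t1 t2 t3
  refine (g.combo (a := a) (b := b) h).congr ?_ ?_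
  · filter_upwards [s1, s2, s3] with x q1 q2 q3
    change _ = (a • G.val + b • H.val : Lp ℝ 2 (vol2 Ω)) (x, y)
    rw [q1, Pi.add_apply, q2, q3]
    rfl
  · filter_upwards [t1, t2, t3] with x q1 q2 q3
    change _ = (a • G.gradX + b • H.gradX : Lp (E d) 2 (vol2 Ω)) (x, y)
    rw [q1, Pi.add_apply, q2, q3]
    rfl

theorem MemX.zero {d : ℕ} {Ω : Set (E d)} : MemX (0 : Triple Ω) := by
  refine ⟨?_, ?_⟩
  · intro φ _ _ _ v
    have e : ∀ {F : Type} [NormedAddCommGroup F],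
        ((0 : Lp F 2 (vol2 Ω)) : E d × E d → F) =ᵐ[vol2 Ω] 0 := Lp.coeFn_zero _ _ _
    have e1 : ∀ w : E d × E d,
        ∫ p, (0 : Lp ℝ 2 (vol2 Ω)) p * fderiv ℝ φ p w ∂(vol2 Ω) = 0 := fun w =>
      integral_eq_zero_of_ae (by
        filter_upwards [e (F := ℝ)] with p hp
        simp only [hp, Pi.zero_apply, zero_mul])
    have e2 : ∫ p, φ p * ⟪(0 : Lp (E d) 2 (vol2 Ω)) p, v⟫_ℝ ∂(vol2 Ω) = 0 :=
      integral_eq_zero_of_ae (by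
        filter_upwards [e (F := E d)] with p hp
        simp only [hp, Pi.zero_apply, inner_zero_left, mul_zero])
    exact ⟨(e1 _).trans (by rw [← neg_zero, ← e2]; rfl),
      (e1 _).trans (by rw [← neg_zero, ← e2]; rfl)⟩
  · have s := ae_slice (Lp.coeFn_zero ℝ 2 (vol2 Ω))
    have t := ae_slice (Lp.coeFn_zero (E d) 2 (vol2 Ω))
    filter_upwards [s, t] with y s t
    exact IsH10.zero.congr (by filter_upwards [s] with x hx; exact hx.symm)
      (by filter_upwards [t] with x hx; exact hx.symm)

/-- The space `X = H¹_{0,x}(Ω×Ω)`, realized inside the Hilbert space of triples as the set of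
`(G, ∇ₓG, ∇ᵧG)`; thus `‖G‖²` in `X` is
`‖G‖²_{L²(Ω×Ω)} + ‖∇ₓG‖²_{L²(Ω×Ω)} + ‖∇ᵧG‖²_{L²(Ω×Ω)}`. -/
def X {d : ℕ} (Ω : Set (E d)) : Submodule ℝ (Triple Ω) where
  carrier := {G | MemX G}
  zero_mem' := MemX.zero
  add_mem' {G H} hG hH := by
    have h := hG.combo (a := 1) (b := 1) hH
    rw [one_smul, one_smul] at h
    exact h
  smul_mem' c G hG := by
    have h := hG.combo (a := c) (b := 0) hG
    rw [zero_smul, add_zero] at h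
    exact h

/-- The data space `Y = L²(Ω)`. -/
abbrev Y {d : ℕ} (Ω : Set (E d)) : Type := Lp ℝ 2 (vol Ω)

/-- `T ∈ L²(Ω×Γ)` is the trace of `G` on `Ω × Γ` (i.e. the boundary values in the variable `y`):
`G` is the limit in `H¹(Ω×Ω)` of functions that are `C¹` up to the boundary and whose restrictions
to `Ω × Γ` converge to `T` in `L²(Ω×Γ)`. -/
def IsTrace {d : ℕ} {Ω : Set (E d)} (G : Triple Ω) (T : Lp ℝ 2 ((vol Ω).prod (surf Ω))) : Prop :=
  ∃ φ : ℕ → E d × E d → ℝ, (∀ n, ContDiff ℝ 1 (φ n)) ∧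
    Tendsto (fun n => eLpNorm (fun p => φ n p - G.val p) 2 (vol2 Ω)) atTop (𝓝 0) ∧
    Tendsto (fun n => eLpNorm
      (fun p => gradient (fun x => φ n (x, p.2)) p.1 - G.gradX p) 2 (vol2 Ω)) atTop (𝓝 0) ∧
    Tendsto (fun n => eLpNorm
      (fun p => gradient (fun y => φ n (p.1, y)) p.2 - G.gradY p) 2 (vol2 Ω)) atTop (𝓝 0) ∧
    Tendsto (fun n => eLpNorm (fun p => φ n p - T p) 2 ((vol Ω).prod (surf Ω))) atTop (𝓝 0)

open scoped Classical in
/-- The trace of `G` on `Ω × Γ`. -/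
def trace {d : ℕ} {Ω : Set (E d)} (G : Triple Ω) : Lp ℝ 2 ((vol Ω).prod (surf Ω)) :=
  if h : ∃ T, IsTrace G T then h.choose else 0

/-- The forward operator
`F(G)(x) = ∫_Γ G(x,y) f₁(y) dS(y) + ∫_Ω G(x,y) f₂(y) dy`,
where `f₁ = D ∇u·n` on `Γ` and `f₂` is the effective source in `Ω`. -/
def forward {d : ℕ} {Ω : Set (E d)} (f₁ : Lp ℝ 2 (surf Ω)) (f₂ : Lp ℝ 2 (vol Ω)) (G : X Ω)
    (x : E d) : ℝ :=
  ∫ y, trace G.1 (x, y) * f₁ y ∂(surf Ω) + ∫ y, G.1.val (x, y) * f₂ y ∂(vol Ω)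

/-- The regularization functional `R(G) = ‖G‖²_X + γ ‖G - Gᵀ‖²_{L²(Ω×Ω)}`. -/
def reg {d : ℕ} {Ω : Set (E d)} (γ : ℝ) (G : X Ω) : ℝ :=
  ‖G‖ ^ 2 + γ * ∫ p, (G.1.val p - G.1.val p.swap) ^ 2 ∂(vol2 Ω)

/-- The Tikhonov functional `J(G; u) = ‖F(G) - u‖²_{L²(Ω)} + α R(G)`. -/
def J {d : ℕ} {Ω : Set (E d)} (f₁ : Lp ℝ 2 (surf Ω)) (f₂ : Lp ℝ 2 (vol Ω)) (α γ : ℝ) (u : Y Ω)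
    (G : X Ω) : ℝ :=
  (eLpNorm (fun x => forward f₁ f₂ G x - u x) 2 (vol Ω)).toReal ^ 2 + α * reg γ G

/-- `G` minimizes `J(·; u)` over `X`. -/
def IsMinimizer {d : ℕ} {Ω : Set (E d)} (f₁ : Lp ℝ 2 (surf Ω)) (f₂ : Lp ℝ 2 (vol Ω)) (α γ : ℝ)
    (u : Y Ω) (G : X Ω) : Prop :=
  ∀ H : X Ω, J f₁ f₂ α γ u G ≤ J f₁ f₂ α γ u H

end GreenTikhonov

end

namespace GreenTikhonov

/-! Minimizing the functional is a linear least-squares problem. With B G = (F(G), √α G, √(αγ)(G −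
Gᵀ)), a bounded operator into a Hilbert product, J(G; u) = ‖B G − (u, 0, 0)‖². The middle component
gives ‖B G‖ ≥ √α ‖G‖, so B has complete range when X is complete, and (u, 0, 0) has a nearest point
in it. Orthogonality of the residuals gives √α ‖G − G'‖ ≤ ‖u − u'‖ for minimizers with data u and
u'; this one estimate (`IsMinimizer.norm_sub_le`) yields both uniqueness and stability. What remains
is that X is complete and that F is bounded.

Completeness (`isClosed_X`): X is closed among L² triples. The weak-gradient identities are
continuous in the triple. For the slice condition, Fatou's lemma shows that almost every slice of a
limit is approximated arbitrarily well by slices in H¹₀(Ω), which is closed.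

Boundedness of F: Cauchy–Schwarz in y reduces it to a bounded trace on Ω × Γ. For C¹ functions the
trace inequality comes from integrating along segments that enter Ω transversally to the boundary
graph (`exists_trace_inequality`). C¹ functions are dense in H¹(Ω × Ω) by shifting inward,
mollifying and patching (`exists_contDiff_approx`). Together these give existence, uniqueness and a
norm bound for the trace. -/

theorem eLpNorm_two_sq {α F : Type*} [MeasurableSpace α] [NormedAddCommGroup F] (f : α → F)
    (μ : Measure α) : eLpNorm f 2 μ ^ 2 = ∫⁻ x, ‖f x‖ₑ ^ 2 ∂μ := by
  simpa using eLpNorm_nnreal_pow_eq_lintegral (f := f) (μ := μ) (p := 2) (by norm_num)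

theorem lintegral_enorm_mul_le {α : Type*} [MeasurableSpace α] {μ : Measure α} {f g : α → ℝ}
    (hf : AEStronglyMeasurable f μ) (hg : AEStronglyMeasurable g μ) :
    ∫⁻ x, ‖f x * g x‖ₑ ∂μ ≤ eLpNorm f 2 μ * eLpNorm g 2 μ := by
  have := eLpNorm_smul_le_mul_eLpNorm (p := 2) (q := 2) (r := 1) hg hf
  rw [eLpNorm_one_eq_lintegral_enorm] at this
  exact this

/-! ### Slices of L² functions on a product and integration against a kernel -/

section Slices

variable {α β : Type*} [MeasurableSpace α] [MeasurableSpace β] {μ : Measure α} {ν : Measure β}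
  [SFinite μ] [SFinite ν]

omit [SFinite μ] in
theorem lintegral_eLpNorm_slice_sq {F : Type*} [NormedAddCommGroup F] {T : α × β → F}
    (hT : AEStronglyMeasurable T (μ.prod ν)) :
    ∫⁻ x, eLpNorm (fun y => T (x, y)) 2 ν ^ 2 ∂μ = eLpNorm T 2 (μ.prod ν) ^ 2 := by
  simp only [eLpNorm_two_sq]
  rw [lintegral_prod _ (hT.enorm.pow_const 2)]

theorem MemLp.ae_slice {F : Type*} [NormedAddCommGroup F] {T : α × β → F}
    (hT : MemLp T 2 (μ.prod ν)) : ∀ᵐ x ∂μ, MemLp (fun y => T (x, y)) 2 ν := by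
  have h : ∫⁻ x, ∫⁻ y, ‖T (x, y)‖ₑ ^ 2 ∂ν ∂μ ≠ ⊤ := by
    have := lintegral_eLpNorm_slice_sq hT.1
    simp only [eLpNorm_two_sq T, eLpNorm_two_sq (fun y => T (_, y))] at this
    rw [this, ← eLpNorm_two_sq]
    exact ENNReal.pow_ne_top hT.2.ne
  have m : AEMeasurable (fun x => ∫⁻ y, ‖T (x, y)‖ₑ ^ 2 ∂ν) μ :=
    (hT.1.enorm.pow_const 2).lintegral_prod_right'
  filter_upwards [ae_lt_top' m h, hT.1.prodMk_left] with x hx hm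
  refine ⟨hm, ?_⟩
  rw [← eLpNorm_two_sq] at hx
  by_contra hc
  simp [not_lt_top_iff.1 hc] at hx

theorem integrable_slice_mul {T : α × β → ℝ} (hT : MemLp T 2 (μ.prod ν)) {f : β → ℝ}
    (hf : MemLp f 2 ν) : ∀ᵐ x ∂μ, Integrable (fun y => T (x, y) * f y) ν := by
  filter_upwards [MemLp.ae_slice hT] with x hx
  exact hx.integrable_mul hf

omit [SFinite μ] in
theorem aestronglyMeasurable_integral_slice_mul {T : α × β → ℝ} (hT : MemLp T 2 (μ.prod ν))
    {f : β → ℝ} (hf : MemLp f 2 ν) :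
    AEStronglyMeasurable (fun x => ∫ y, T (x, y) * f y ∂ν) μ :=
  (hT.1.mul (hf.1.comp_snd (μ := μ))).integral_prod_right'

/-- Cauchy–Schwarz in y for almost every fixed x, then squaring and Tonelli in x. -/
theorem eLpNorm_integral_slice_mul_le {T : α × β → ℝ} (hT : MemLp T 2 (μ.prod ν)) {f : β → ℝ}
    (hf : MemLp f 2 ν) :
    eLpNorm (fun x => ∫ y, T (x, y) * f y ∂ν) 2 μ ≤ eLpNorm f 2 ν * eLpNorm T 2 (μ.prod ν) := by
  rw [← (ENNReal.pow_right_strictMono two_ne_zero).le_iff_le, eLpNorm_two_sq, mul_pow,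
    ← lintegral_eLpNorm_slice_sq hT.1, ← lintegral_const_mul' _ _ (ENNReal.pow_ne_top hf.2.ne)]
  refine lintegral_mono_ae ?_
  filter_upwards [MemLp.ae_slice hT] with x hx
  rw [← mul_pow]
  refine pow_le_pow_left₀ bot_le ?_ 2
  refine (enorm_integral_le_lintegral_enorm _).trans ?_
  rw [mul_comm]
  exact lintegral_enorm_mul_le hx.1 hf.1

theorem memLp_integral_slice_mul {T : α × β → ℝ} (hT : MemLp T 2 (μ.prod ν)) {f : β → ℝ}
    (hf : MemLp f 2 ν) : MemLp (fun x => ∫ y, T (x, y) * f y ∂ν) 2 μ :=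
  ⟨aestronglyMeasurable_integral_slice_mul hT hf,
    (eLpNorm_integral_slice_mul_le hT hf).trans_lt (ENNReal.mul_lt_top hf.2 hT.2)⟩

/-- The linear map `T ↦ ∫ T(·, y) f(y) dν(y)` from `L²(μ × ν)` to `L²(μ)`. -/
noncomputable def sliceIntegralₗ (μ : Measure α) [SFinite μ] (f : Lp ℝ 2 ν) :
    Lp ℝ 2 (μ.prod ν) →ₗ[ℝ] Lp ℝ 2 μ where
  toFun T := (memLp_integral_slice_mul (Lp.memLp T) (Lp.memLp f)).toLp _
  map_add' S T := by
    rw [← MemLp.toLp_add]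
    refine MemLp.toLp_congr _ _ ?_
    filter_upwards [Measure.ae_ae_of_ae_prod (Lp.coeFn_add S T),
      integrable_slice_mul (Lp.memLp S) (Lp.memLp f),
      integrable_slice_mul (Lp.memLp T) (Lp.memLp f)] with x h h1 h2
    rw [Pi.add_apply, ← integral_add h1 h2]
    refine integral_congr_ae ?_
    filter_upwards [h] with y hy
    rw [hy, Pi.add_apply, add_mul]
  map_smul' c T := by
    rw [RingHom.id_apply, ← MemLp.toLp_const_smul]
    refine MemLp.toLp_congr _ _ ?_
    filter_upwards [Measure.ae_ae_of_ae_prod (Lp.coeFn_smul c T)] with x h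
    rw [Pi.smul_apply, smul_eq_mul, ← integral_const_mul]
    refine integral_congr_ae ?_
    filter_upwards [h] with y hy
    rw [hy, Pi.smul_apply, smul_eq_mul, mul_assoc]

theorem norm_sliceIntegralₗ_le (f : Lp ℝ 2 ν) (T : Lp ℝ 2 (μ.prod ν)) :
    ‖sliceIntegralₗ μ f T‖ ≤ ‖f‖ * ‖T‖ := by
  have e : ‖sliceIntegralₗ μ f T‖ = _ :=
    Lp.norm_toLp _ (memLp_integral_slice_mul (Lp.memLp T) (Lp.memLp f))
  rw [e, Lp.norm_def f, Lp.norm_def T, ← ENNReal.toReal_mul]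
  exact ENNReal.toReal_mono (ENNReal.mul_ne_top (Lp.eLpNorm_ne_top f) (Lp.eLpNorm_ne_top T))
    (eLpNorm_integral_slice_mul_le (Lp.memLp T) (Lp.memLp f))

/-- The operator `T ↦ ∫ T(·, y) f(y) dν(y)` from `L²(μ × ν)` to `L²(μ)`. -/
noncomputable def sliceIntegral (μ : Measure α) [SFinite μ] (f : Lp ℝ 2 ν) :
    Lp ℝ 2 (μ.prod ν) →L[ℝ] Lp ℝ 2 μ :=
  (sliceIntegralₗ μ f).mkContinuous ‖f‖ (norm_sliceIntegralₗ_le f)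

theorem coeFn_sliceIntegral (f : Lp ℝ 2 ν) (T : Lp ℝ 2 (μ.prod ν)) :
    sliceIntegral μ f T =ᵐ[μ] fun x => ∫ y, T (x, y) * f y ∂ν :=
  MemLp.coeFn_toLp (memLp_integral_slice_mul (Lp.memLp T) (Lp.memLp f))

end Slices

/-! ### Linear least squares for an operator bounded below -/

section LeastSquares

variable {H W : Type*} [NormedAddCommGroup H] [InnerProductSpace ℝ H] [NormedAddCommGroup W]
  [InnerProductSpace ℝ W]

/-- The normal equations: B x realizes the distance from w to the range of B, so the residual is
orthogonal to that subspace. No completeness enters, because the minimizer is given. -/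
theorem inner_eq_zero_of_forall_norm_sub_le (B : H →L[ℝ] W) {w : W} {x : H}
    (h : ∀ y, ‖B x - w‖ ≤ ‖B y - w‖) (y : H) : ⟪w - B x, B y⟫_ℝ = 0 := by
  refine ((LinearMap.range (B : H →ₗ[ℝ] W)).norm_eq_iInf_iff_real_inner_eq_zero
    (u := w) (v := B x) ⟨x, rfl⟩).1 ?_ (B y) ⟨y, rfl⟩
  refine le_antisymm (le_ciInf ?_) (ciInf_le ⟨0, ?_⟩ (⟨B x, ⟨x, rfl⟩⟩ :
    (LinearMap.range (B : H →ₗ[ℝ] W) : Set W)))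
  · rintro ⟨_, z, rfl⟩
    have := h z
    rwa [norm_sub_rev, norm_sub_rev (B z)] at this
  · rintro _ ⟨z, rfl⟩
    exact norm_nonneg _

/-- The lower bound makes B antilipschitz, so its range inherits completeness from H and contains a
point nearest to w; W itself need not be complete. -/
theorem exists_forall_norm_sub_le [CompleteSpace H] (B : H →L[ℝ] W) {c : ℝ} (hc : 0 < c)
    (hB : ∀ x, c * ‖x‖ ≤ ‖B x‖) (w : W) : ∃ x, ∀ y, ‖B x - w‖ ≤ ‖B y - w‖ := by
  have ha : AntilipschitzWith (Real.toNNReal c⁻¹) B := by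
    refine B.antilipschitz_of_bound fun x => ?_
    rw [Real.coe_toNNReal _ (inv_pos.2 hc).le, ← div_eq_inv_mul, le_div_iff₀' hc]
    exact hB x
  have hcl : IsComplete (LinearMap.range (B : H →ₗ[ℝ] W) : Set W) :=
    ha.isComplete_range B.uniformContinuous
  obtain ⟨v, ⟨x, rfl⟩, hv⟩ :=
    (LinearMap.range (B : H →ₗ[ℝ] W)).exists_norm_eq_iInf_of_complete_subspace hcl w
  refine ⟨x, fun y => ?_⟩
  rw [norm_sub_rev, norm_sub_rev (B y)]
  exact hv.le.trans (ciInf_le ⟨0, by rintro _ ⟨z, rfl⟩; exact norm_nonneg _⟩ (⟨B y, ⟨y, rfl⟩⟩ :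
    (LinearMap.range (B : H →ₗ[ℝ] W) : Set W)))

/-- Testing both normal equations with B (x − x') and subtracting gives ‖B (x − x')‖² = ⟪w − w', B
(x − x')⟫; Cauchy–Schwarz and the lower bound conclude. -/
theorem norm_sub_le_of_minimizers (B : H →L[ℝ] W) {c : ℝ}
    (hB : ∀ x, c * ‖x‖ ≤ ‖B x‖) {w w' : W} {x x' : H} (h : ∀ y, ‖B x - w‖ ≤ ‖B y - w‖)
    (h' : ∀ y, ‖B x' - w'‖ ≤ ‖B y - w'‖) : c * ‖x - x'‖ ≤ ‖w - w'‖ := by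
  refine (hB _).trans ?_
  have e1 := inner_eq_zero_of_forall_norm_sub_le B h (x - x')
  have e2 := inner_eq_zero_of_forall_norm_sub_le B h' (x - x')
  have e : ‖B (x - x')‖ * ‖B (x - x')‖ = ⟪w - w', B (x - x')⟫_ℝ := by
    rw [← real_inner_self_eq_norm_mul_norm]
    nth_rewrite 1 [map_sub]
    simp only [inner_sub_left] at e1 e2 ⊢
    linarith
  have k := real_inner_le_norm (w - w') (B (x - x'))
  rw [← e] at k
  rcases (norm_nonneg (B (x - x'))).eq_or_lt with h0 | h0
  · rw [← h0]
    exact norm_nonneg _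
  · exact le_of_mul_le_mul_right k h0

end LeastSquares

/-! ### Closedness of X in the space of triples -/

section Closedness

variable {d : ℕ} {Ω : Set (E d)}

theorem continuous_integral_inner {α F : Type*} [MeasurableSpace α] [NormedAddCommGroup F]
    [InnerProductSpace ℝ F] {μ : Measure α} {ψ : α → F} (hψ : MemLp ψ 2 μ) :
    Continuous fun f : Lp F 2 μ => ∫ p, ⟪f p, ψ p⟫_ℝ ∂μ := by
  have e : (fun f : Lp F 2 μ => ∫ p, ⟪f p, ψ p⟫_ℝ ∂μ) =
      fun f : Lp F 2 μ => ⟪f, hψ.toLp ψ⟫_ℝ := by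
    funext f
    rw [L2.inner_def]
    refine integral_congr_ae ?_
    filter_upwards [hψ.coeFn_toLp] with p hp
    rw [hp]
  rw [e]
  fun_prop

theorem continuous_val : Continuous (Triple.val : Triple Ω → _) := by
  unfold Triple.val; fun_prop

theorem continuous_gradX : Continuous (Triple.gradX : Triple Ω → _) := by
  unfold Triple.gradX; fun_prop

theorem continuous_gradY : Continuous (Triple.gradY : Triple Ω → _) := by
  unfold Triple.gradY; fun_prop

/-- For a fixed test function and direction, both sides of each identity are L² inner products with
fixed functions, hence continuous in the triple. -/
theorem isClosed_isH1 : IsClosed {G : Triple Ω | IsH1 G} := by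
  simp only [IsH1, Set.ofPred_forall, Set.ofPred_and]
  refine isClosed_iInter fun φ => isClosed_iInter fun hφ => isClosed_iInter fun hc =>
    isClosed_iInter fun _ => isClosed_iInter fun v => ?_
  have hd : ∀ w : E d × E d, MemLp (fun p => fderiv ℝ φ p w) 2 (vol2 Ω) := fun w =>
    ((hφ.continuous_fderiv (by simp)).clm_apply continuous_const).memLp_of_hasCompactSupport
      (hc.fderiv_apply (𝕜 := ℝ) w)
  have hv : MemLp (fun p => φ p • v) 2 (vol2 Ω) :=
    (hφ.continuous.smul continuous_const).memLp_of_hasCompactSupport (hc.smul_right)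
  have c1 : ∀ w : E d × E d,
      Continuous fun f : Lp ℝ 2 (vol2 Ω) => ∫ p, f p * fderiv ℝ φ p w ∂(vol2 Ω) := fun w => by
    refine (continuous_integral_inner (hd w)).congr fun f => ?_
    refine integral_congr_ae (ae_of_all _ fun p => ?_)
    simp [mul_comm]
  have c2 : Continuous fun f : Lp (E d) 2 (vol2 Ω) => -∫ p, φ p * ⟪f p, v⟫_ℝ ∂(vol2 Ω) := by
    refine (continuous_integral_inner hv).neg.congr fun f => ?_
    simp only [real_inner_smul_right, Pi.neg_apply]
  exact (isClosed_eq ((c1 _).comp continuous_val) (c2.comp continuous_gradX)).inter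
    (isClosed_eq ((c1 _).comp continuous_val) (c2.comp continuous_gradY))

theorem eLpNorm_sub_le_add {α F : Type*} [MeasurableSpace α] {μ : Measure α} [NormedAddCommGroup F]
    {f g h : α → F} (hf : AEStronglyMeasurable f μ) (hg : AEStronglyMeasurable g μ)
    (hh : AEStronglyMeasurable h μ) :
    eLpNorm (fun x => f x - h x) 2 μ ≤
      eLpNorm (fun x => f x - g x) 2 μ + eLpNorm (fun x => g x - h x) 2 μ := by
  have e : (fun x => f x - h x) = (fun x => f x - g x) + (fun x => g x - h x) := by
    funext x; simp
  rw [e]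
  exact eLpNorm_add_le (hf.sub hg) (hg.sub hh) (by norm_num)

theorem aestronglyMeasurable_gradient {φ : E d → ℝ} (hφ : ContDiff ℝ 1 φ) (μ : Measure (E d)) :
    AEStronglyMeasurable (gradient φ) μ :=
  ((InnerProductSpace.toDual ℝ (E d)).symm.continuous.comp
    (hφ.continuous_fderiv (by simp))).aestronglyMeasurable

/-- H¹₀(Ω) is closed in the graph norm. The hypothesis asks only for some approximant at each ε, not
for a convergent sequence, which is what Fatou's lemma delivers for slices. -/
theorem IsH10.of_approx {u : E d → ℝ} {h : E d → E d} (hu : MemLp u 2 (vol Ω))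
    (hh : MemLp h 2 (vol Ω))
    (H : ∀ ε : ENNReal, 0 < ε → ∃ u' h', IsH10 Ω u' h' ∧
      eLpNorm (fun x => u' x - u x) 2 (vol Ω) < ε ∧
      eLpNorm (fun x => h' x - h x) 2 (vol Ω) < ε) : IsH10 Ω u h := by
  have key : ∀ ε : ENNReal, 0 < ε → ∃ φ : E d → ℝ,
      (ContDiff ℝ ∞ φ ∧ HasCompactSupport φ ∧ tsupport φ ⊆ Ω) ∧
      eLpNorm (fun x => φ x - u x) 2 (vol Ω) ≤ ε ∧
      eLpNorm (fun x => gradient φ x - h x) 2 (vol Ω) ≤ ε := by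
    intro ε hε
    have h2 : 0 < ε / 2 := ENNReal.half_pos hε.ne'
    obtain ⟨u', h', ⟨m1, m2, φ, hφ, l1, l2⟩, k1, k2⟩ := H _ h2
    obtain ⟨n, n1, n2⟩ := ((l1.eventually (gt_mem_nhds h2)).and
      (l2.eventually (gt_mem_nhds h2))).exists
    refine ⟨φ n, hφ n, ?_, ?_⟩
    · refine (eLpNorm_sub_le_add (hφ n).1.continuous.aestronglyMeasurable m1.1 hu.1).trans ?_
      exact (add_le_add n1.le k1.le).trans (ENNReal.add_halves ε).le
    · refine (eLpNorm_sub_le_add (aestronglyMeasurable_gradient ((hφ n).1.of_le (by simp)) _)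
        m2.1 hh.1).trans ?_
      exact (add_le_add n2.le k2.le).trans (ENNReal.add_halves ε).le
  -- The tolerance at n = 0 is ∞, which is positive and harmless in the limit.
  choose φ hφ k1 k2 using fun n : ℕ => key ((n : ENNReal)⁻¹) (by simp)
  refine ⟨hu, hh, φ, hφ, ?_, ?_⟩
  · exact tendsto_of_tendsto_of_tendsto_of_le_of_le tendsto_const_nhds
      ENNReal.tendsto_inv_nat_nhds_zero (fun _ => bot_le) k1
  · exact tendsto_of_tendsto_of_tendsto_of_le_of_le tendsto_const_nhds
      ENNReal.tendsto_inv_nat_nhds_zero (fun _ => bot_le) k2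

section

variable {α β F : Type*} [MeasurableSpace α] [MeasurableSpace β] {μ : Measure α} {ν : Measure β}
  [SFinite μ] [SFinite ν] [NormedAddCommGroup F]

theorem lintegral_eLpNorm_slice_sq_symm {T : α × β → F}
    (hT : AEStronglyMeasurable T (μ.prod ν)) :
    ∫⁻ y, eLpNorm (fun x => T (x, y)) 2 μ ^ 2 ∂ν = eLpNorm T 2 (μ.prod ν) ^ 2 := by
  simp only [eLpNorm_two_sq]
  rw [lintegral_prod_symm _ (hT.enorm.pow_const 2)]

theorem aemeasurable_eLpNorm_slice_sq_symm {T : α × β → F}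
    (hT : AEStronglyMeasurable T (μ.prod ν)) :
    AEMeasurable (fun y => eLpNorm (fun x => T (x, y)) 2 μ ^ 2) ν := by
  simp only [eLpNorm_two_sq]
  exact (hT.enorm.pow_const 2).lintegral_prod_left'

theorem MemLp.ae_slice_symm {T : α × β → F} (hT : MemLp T 2 (μ.prod ν)) :
    ∀ᵐ y ∂ν, MemLp (fun x => T (x, y)) 2 μ :=
  MemLp.ae_slice (T := fun p => T p.swap)
    (hT.comp_measurePreserving Measure.measurePreserving_swap)

end

/-- By Fatou the liminf of the sequence has zero integral, so it vanishes almost everywhere. This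
replaces the extraction of an almost everywhere convergent subsequence. -/
theorem exists_lt_of_tendsto_lintegral_zero {α : Type*} [MeasurableSpace α] {μ : Measure α}
    {a : ℕ → α → ENNReal} (ha : ∀ n, AEMeasurable (a n) μ)
    (h : Tendsto (fun n => ∫⁻ x, a n x ∂μ) atTop (𝓝 0)) :
    ∀ᵐ x ∂μ, ∀ ε : ENNReal, 0 < ε → ∃ n, a n x < ε := by
  set b : ℕ → α → ENNReal := fun n => (ha n).mk (a n) with hb
  have hm : ∀ n, Measurable (b n) := fun n => (ha n).measurable_mk
  have e : ∀ n, a n =ᵐ[μ] b n := fun n => (ha n).ae_eq_mk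
  have hl : Tendsto (fun n => ∫⁻ x, b n x ∂μ) atTop (𝓝 0) :=
    h.congr fun n => lintegral_congr_ae (e n)
  have h0 : ∫⁻ x, liminf (fun n => b n x) atTop ∂μ = 0 :=
    le_antisymm ((lintegral_liminf_le hm).trans hl.liminf_eq.le) bot_le
  rw [lintegral_eq_zero_iff (Measurable.liminf hm)] at h0
  filter_upwards [h0, ae_all_iff.2 e] with x hx hab ε hε
  simp only [hab]
  by_contra! hc
  have : ε ≤ liminf (fun n => b n x) atTop := by
    refine le_liminf_of_le ?_ (Eventually.of_forall hc)
    isBoundedDefault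
  rw [hx] at this
  exact absurd hε (not_lt.2 this)

theorem isClosed_X : IsClosed (X Ω : Set (Triple Ω)) := by
  refine IsSeqClosed.isClosed fun G G₀ hG hl => ?_
  refine ⟨isClosed_isH1.mem_of_tendsto hl (Eventually.of_forall fun n => (hG n).1), ?_⟩
  have l1 : Tendsto (fun n => eLpNorm (fun p => (G n).val p - G₀.val p) 2 (vol2 Ω)) atTop (𝓝 0) :=
    (Lp.tendsto_Lp_iff_tendsto_eLpNorm' _ _).1 ((continuous_val.tendsto _).comp hl)
  have l2 : Tendsto (fun n => eLpNorm (fun p => (G n).gradX p - G₀.gradX p) 2 (vol2 Ω)) atTop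
      (𝓝 0) :=
    (Lp.tendsto_Lp_iff_tendsto_eLpNorm' _ _).1 ((continuous_gradX.tendsto _).comp hl)
  have s1 : ∀ n, AEStronglyMeasurable (fun p => (G n).val p - G₀.val p) (vol2 Ω) := fun n =>
    (Lp.aestronglyMeasurable _).sub (Lp.aestronglyMeasurable _)
  have s2 : ∀ n, AEStronglyMeasurable (fun p => (G n).gradX p - G₀.gradX p) (vol2 Ω) := fun n =>
    (Lp.aestronglyMeasurable _).sub (Lp.aestronglyMeasurable _)
  -- The two squared slice errors are added so that one index serves both the function and its
  -- gradient.
  have key := exists_lt_of_tendsto_lintegral_zero (μ := vol Ω)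
    (a := fun n y => eLpNorm (fun x => (G n).val (x, y) - G₀.val (x, y)) 2 (vol Ω) ^ 2 +
      eLpNorm (fun x => (G n).gradX (x, y) - G₀.gradX (x, y)) 2 (vol Ω) ^ 2)
    (fun n => (aemeasurable_eLpNorm_slice_sq_symm (s1 n)).add
      (aemeasurable_eLpNorm_slice_sq_symm (s2 n))) (by
    have e : ∀ n, ∫⁻ y, (eLpNorm (fun x => (G n).val (x, y) - G₀.val (x, y)) 2 (vol Ω) ^ 2 +
        eLpNorm (fun x => (G n).gradX (x, y) - G₀.gradX (x, y)) 2 (vol Ω) ^ 2) ∂(vol Ω) =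
        eLpNorm (fun p => (G n).val p - G₀.val p) 2 (vol2 Ω) ^ 2 +
        eLpNorm (fun p => (G n).gradX p - G₀.gradX p) 2 (vol2 Ω) ^ 2 := fun n => by
      rw [lintegral_add_left' (aemeasurable_eLpNorm_slice_sq_symm (s1 n)),
        lintegral_eLpNorm_slice_sq_symm (s1 n), lintegral_eLpNorm_slice_sq_symm (s2 n)]
    simp only [e]
    have := ((ENNReal.continuous_pow 2).tendsto _ |>.comp l1).add
      ((ENNReal.continuous_pow 2).tendsto _ |>.comp l2)
    simpa using this)
  filter_upwards [key, ae_all_iff.2 fun n => (hG n).2, MemLp.ae_slice_symm (Lp.memLp G₀.val),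
    MemLp.ae_slice_symm (Lp.memLp G₀.gradX)] with y hy hH m1 m2
  refine IsH10.of_approx m1 m2 fun ε hε => ?_
  obtain ⟨n, hn⟩ := hy (ε ^ 2) (by positivity)
  refine ⟨_, _, hH n, ?_, ?_⟩
  · exact (ENNReal.pow_right_strictMono two_ne_zero).lt_iff_lt.1 (le_self_add.trans_lt hn)
  · exact (ENNReal.pow_right_strictMono two_ne_zero).lt_iff_lt.1 (le_add_self.trans_lt hn)

theorem completeSpace_X : CompleteSpace (X Ω) :=
  isClosed_X.completeSpace_coe

end Closedness

/-! ### The trace inequality on a Lipschitz boundary -/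

theorem ennreal_add_sq_le (a b : ENNReal) : (a + b) ^ 2 ≤ 2 * (a ^ 2 + b ^ 2) := by
  have := ENNReal.rpow_add_le_mul_rpow_add_rpow a b (p := 2) (by norm_num)
  norm_num at this
  exact_mod_cast this

theorem _root_.LipschitzWith.euclideanHausdorffMeasure_image_le {X Y : Type*} [EMetricSpace X]
    [MeasurableSpace X] [BorelSpace X] [EMetricSpace Y] [MeasurableSpace Y] [BorelSpace Y]
    {f : X → Y} {K : NNReal} (hf : LipschitzWith K f) (m : ℕ) (s : Set X) :
    (Measure.euclideanHausdorffMeasure m : Measure Y) (f '' s) ≤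
      (K : ENNReal) ^ m * (Measure.euclideanHausdorffMeasure m : Measure X) s := by
  have k := hf.hausdorffMeasure_image_le (d := m) (by positivity) s
  rw [ENNReal.rpow_natCast] at k
  rw [Measure.euclideanHausdorffMeasure_def, Measure.euclideanHausdorffMeasure_def,
    Measure.smul_apply, Measure.smul_apply, ENNReal.smul_def, ENNReal.smul_def, smul_eq_mul,
    smul_eq_mul, mul_left_comm]
  gcongr

section Hyperplane

variable {V : Type*} [NormedAddCommGroup V] [InnerProductSpace ℝ V] [FiniteDimensional ℝ V]
  [MeasurableSpace V] [BorelSpace V] {ν : V}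

/-- The orthogonal splitting into the line of ν and its complement is an isometry, and so is t ↦ t ν
onto that line; isometries preserve volume. This is what allows Fubini in the direction ν. -/
theorem measurePreserving_add_smul_unit (hν : ‖ν‖ = 1) :
    MeasurePreserving (fun q : (ℝ ∙ ν)ᗮ × ℝ => (q.1 : V) + q.2 • ν)
      (volume.prod volume) volume := by
  have h1 := (LinearIsometryEquiv.toSpanUnitSingleton (𝕜 := ℝ) ν hν).measurePreserving.prod
    (MeasurePreserving.id (volume : Measure (ℝ ∙ ν)ᗮ))
  have h2 := ((ℝ ∙ ν).orthogonalDecomposition.symm).measurePreserving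
  have h3 := WithLp.volume_preserving_toLp (ℝ ∙ ν) (ℝ ∙ ν)ᗮ
  have h := ((h2.comp h3).comp h1).comp
    (Measure.measurePreserving_swap (μ := (volume : Measure (ℝ ∙ ν)ᗮ)) (ν := (volume : Measure ℝ)))
  refine (congrArg (fun F => MeasurePreserving F _ _) ?_).mp h
  funext q
  simp [Function.comp, add_comm]

theorem lintegral_add_smul_unit (hν : ‖ν‖ = 1) {F : V → ENNReal} (hF : Measurable F) :
    ∫⁻ z : (ℝ ∙ ν)ᗮ, ∫⁻ t : ℝ, F (z + t • ν) = ∫⁻ x, F x := by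
  rw [← (measurePreserving_add_smul_unit hν).lintegral_comp hF, lintegral_prod]
  exact (hF.comp (measurePreserving_add_smul_unit hν).measurable).aemeasurable

/-- The `(m-1)`-dimensional measure on a piece of a Lipschitz graph is bounded by a multiple of the
parameter measure. -/
theorem euclideanHausdorffMeasure_restrict_graph_le {m : ℕ} (hm : Module.finrank ℝ V = m + 1)
    (hν : ‖ν‖ = 1) {K : NNReal} {g : V → ℝ} (hg : LipschitzWith K g)
    (hinv : ∀ (x : V) (t : ℝ), g (x + t • ν) = g x) {S : Set V}
    (hSg : ∀ x ∈ S, g x = ⟪x, ν⟫_ℝ) :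
    (Measure.euclideanHausdorffMeasure m).restrict S ≤
      ((1 + K) ^ m : NNReal) •
        (volume : Measure (ℝ ∙ ν)ᗮ).map (fun z : (ℝ ∙ ν)ᗮ => (z : V) + g z • ν) := by
  have : Fact (Module.finrank ℝ V = m + 1) := ⟨hm⟩
  have hν0 : ν ≠ 0 := by rintro rfl; simp at hν
  have hfin : Module.finrank ℝ (ℝ ∙ ν)ᗮ = m := Submodule.finrank_orthogonal_span_singleton hν0
  -- The inclusion contributes 1 and the height g contributes K.
  have hL : LipschitzWith (1 + K) (fun z : (ℝ ∙ ν)ᗮ => (z : V) + g z • ν) := by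
    refine (LipschitzWith.subtype_val _).add (LipschitzWith.of_dist_le_mul fun x y => ?_)
    rw [dist_eq_norm, ← sub_smul, norm_smul, hν, mul_one, ← dist_eq_norm]
    exact hg.dist_le_mul x y
  refine Measure.le_iff.2 fun A hA => ?_
  rw [Measure.restrict_apply hA, Measure.smul_apply, Measure.map_apply hL.continuous.measurable hA]
  -- A point of S is the image of its projection to the hyperplane: invariance of g along ν gives
  -- both points the same height.
  have hsub : A ∩ S ⊆ (fun z : (ℝ ∙ ν)ᗮ => (z : V) + g z • ν) ''
      ((fun z : (ℝ ∙ ν)ᗮ => (z : V) + g z • ν) ⁻¹' A) := by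
    rintro x ⟨hxA, hxS⟩
    have hz : x + (-⟪x, ν⟫_ℝ) • ν ∈ (ℝ ∙ ν)ᗮ := by
      rw [Submodule.mem_orthogonal_singleton_iff_inner_left]
      simp [inner_add_left, real_inner_smul_left, hν]
    have e : (x + (-⟪x, ν⟫_ℝ) • ν) + g (x + (-⟪x, ν⟫_ℝ) • ν) • ν = x := by
      rw [hinv, hSg x hxS]
      simp
    refine ⟨⟨_, hz⟩, ?_, e⟩
    simp only [Set.mem_preimage]
    rw [e]
    exact hxA
  have hvol : (volume : Measure (ℝ ∙ ν)ᗮ) = Measure.euclideanHausdorffMeasure m := by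
    rw [← InnerProductSpace.euclideanHausdorffMeasure_eq_volume, hfin]
  rw [hvol, ENNReal.smul_def, smul_eq_mul]
  push_cast
  simpa using (measure_mono hsub).trans (hL.euclideanHausdorffMeasure_image_le m _)

end Hyperplane

theorem norm_gradient {d : ℕ} (φ : E d → ℝ) (x : E d) : ‖gradient φ x‖ = ‖fderiv ℝ φ x‖ :=
  LinearIsometryEquiv.norm_map _ _

/-- The fundamental theorem of calculus along the segment, then Cauchy–Schwarz against the constant
1 on (0, δ), which produces the factor δ. -/
theorem enorm_sub_sq_le_lintegral {d : ℕ} {φ : E d → ℝ} (hφ : ContDiff ℝ 1 φ) {ν : E d}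
    (hν : ‖ν‖ = 1) {δ t : ℝ} (ht : t ∈ Set.Ioo 0 δ) (y : E d) :
    ‖φ (y + t • ν) - φ y‖ₑ ^ 2 ≤
      ENNReal.ofReal δ * ∫⁻ s in Set.Ioo 0 δ, ‖gradient φ (y + s • ν)‖ₑ ^ 2 := by
  have hc : Continuous fun s : ℝ => fderiv ℝ φ (y + s • ν) ν :=
    ((hφ.continuous_fderiv (by simp)).comp (by fun_prop)).clm_apply continuous_const
  have hgc : Continuous fun s : ℝ => ‖gradient φ (y + s • ν)‖ := by
    simp only [norm_gradient]
    exact ((hφ.continuous_fderiv (by simp)).comp (by fun_prop)).norm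
  have e : φ (y + t • ν) - φ y = ∫ s in (0 : ℝ)..t, fderiv ℝ φ (y + s • ν) ν := by
    rw [intervalIntegral.integral_eq_sub_of_hasDerivAt (f := fun s => φ (y + s • ν))
      (fun s _ => ?_) (hc.intervalIntegrable _ _)]
    · simp
    · have h1 : HasFDerivAt φ (fderiv ℝ φ (y + s • ν)) (y + s • ν) :=
        ((hφ.differentiable (by simp)) _).hasFDerivAt
      have h2 : HasDerivAt (fun s : ℝ => y + s • ν) ν s := by
        simpa using ((hasDerivAt_id s).smul_const ν).const_add y
      exact h1.comp_hasDerivAt s h2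
  have h1 : ‖φ (y + t • ν) - φ y‖ₑ ≤
      ∫⁻ s in Set.Ioo 0 δ, ‖(1 : ℝ) * ‖gradient φ (y + s • ν)‖‖ₑ := by
    rw [e, intervalIntegral.integral_of_le ht.1.le]
    refine (enorm_integral_le_lintegral_enorm _).trans ?_
    refine (lintegral_mono fun s => ?_).trans (lintegral_mono_set (Set.Ioc_subset_Ioo_right ht.2))
    rw [one_mul, enorm_norm, enorm_le_iff_norm_le, norm_gradient]
    simpa [hν] using (fderiv ℝ φ (y + s • ν)).le_opNorm ν
  refine (pow_le_pow_left₀ bot_le (h1.trans (lintegral_enorm_mul_le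
    aestronglyMeasurable_const hgc.aestronglyMeasurable)) 2).trans ?_
  rw [mul_pow, eLpNorm_two_sq, eLpNorm_two_sq]
  simp

/-- The previous bound is averaged over the endpoint t in (0, δ): a boundary value is controlled by
values and gradients along a segment. -/
theorem enorm_sq_le_lintegral {d : ℕ} {φ : E d → ℝ} (hφ : ContDiff ℝ 1 φ) {ν : E d}
    (hν : ‖ν‖ = 1) {δ : ℝ} (y : E d) :
    ENNReal.ofReal δ * ‖φ y‖ₑ ^ 2 ≤
      2 * (∫⁻ s in Set.Ioo 0 δ, ‖φ (y + s • ν)‖ₑ ^ 2) + 2 * ENNReal.ofReal δ ^ 2 *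
        ∫⁻ s in Set.Ioo 0 δ, ‖gradient φ (y + s • ν)‖ₑ ^ 2 := by
  set I := ∫⁻ s in Set.Ioo 0 δ, ‖gradient φ (y + s • ν)‖ₑ ^ 2
  have hp : ∀ t ∈ Set.Ioo 0 δ, ‖φ y‖ₑ ^ 2 ≤ 2 * ‖φ (y + t • ν)‖ₑ ^ 2 +
      2 * (ENNReal.ofReal δ * I) := by
    intro t ht
    have h1 : ‖φ y‖ₑ ≤ ‖φ (y + t • ν)‖ₑ + ‖φ (y + t • ν) - φ y‖ₑ := by
      have := enorm_sub_le (E := ℝ) (a := φ (y + t • ν)) (b := φ (y + t • ν) - φ y)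
      simpa using this
    refine (pow_le_pow_left₀ bot_le h1 2).trans ((ennreal_add_sq_le _ _).trans ?_)
    rw [mul_add]
    gcongr
    exact enorm_sub_sq_le_lintegral hφ hν ht y
  have hm : Measurable fun t : ℝ => 2 * ‖φ (y + t • ν)‖ₑ ^ 2 :=
    ((hφ.continuous.comp (by fun_prop : Continuous fun t : ℝ => y + t • ν)).measurable.enorm.pow_const
      2).const_mul 2
  have := setLIntegral_mono' (μ := volume) measurableSet_Ioo hp
  rw [lintegral_add_left hm, lintegral_const_mul' _ _ (by simp)] at this
  simp only [lintegral_const, Measure.restrict_apply MeasurableSet.univ, Set.univ_inter,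
    Real.volume_Ioo, sub_zero] at this
  rw [mul_comm]
  refine this.trans (le_of_eq ?_)
  ring

theorem le_inner_of_mem_closure {d : ℕ} {Ω : Set (E d)} {p ν : E d} {r : ℝ} {g : E d → ℝ}
    (hg : Continuous g) (h : ∀ x ∈ Metric.ball p r, x ∈ Ω ↔ g x < ⟪x, ν⟫_ℝ) {x : E d}
    (hx : x ∈ closure Ω) (hxp : x ∈ Metric.ball p r) : g x ≤ ⟪x, ν⟫_ℝ := by
  by_contra! hlt
  have ho : IsOpen (Metric.ball p r ∩ {z | ⟪z, ν⟫_ℝ < g z}) :=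
    Metric.isOpen_ball.inter (isOpen_lt (by fun_prop) hg)
  obtain ⟨z, ⟨hz1, hz2⟩, hz⟩ := mem_closure_iff.1 hx _ ho ⟨hxp, hlt⟩
  exact lt_asymm ((h z hz1).1 hz) hz2

/-- Moving by t ν raises the height by t and leaves g unchanged, so a point on or above the graph
moves strictly above it; the two halves of r keep it in the ball where the graph describes Ω. -/
theorem add_smul_mem_of_mem_closure {d : ℕ} {Ω : Set (E d)} {p ν : E d} {r : ℝ} {g : E d → ℝ}
    (hν : ‖ν‖ = 1) (hg : Continuous g) (hinv : ∀ (x : E d) (t : ℝ), g (x + t • ν) = g x)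
    (h : ∀ x ∈ Metric.ball p r, x ∈ Ω ↔ g x < ⟪x, ν⟫_ℝ) {x : E d} (hx : x ∈ closure Ω)
    (hxp : x ∈ Metric.ball p (r / 2)) {t : ℝ} (ht : t ∈ Set.Ioo 0 (r / 2)) : x + t • ν ∈ Ω := by
  have hr : r / 2 ≤ r := by linarith [ht.1, ht.2]
  rw [h, hinv, inner_add_left, real_inner_smul_left, real_inner_self_eq_norm_sq, hν]
  · linarith [ht.1, le_inner_of_mem_closure hg h hx (Metric.ball_subset_ball hr hxp)]
  · rw [Metric.mem_ball] at hxp ⊢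
    calc dist (x + t • ν) p ≤ dist (x + t • ν) x + dist x p := dist_triangle _ _ _
      _ < r / 2 + r / 2 := by
        refine add_lt_add ?_ hxp
        rw [dist_self_add_left, norm_smul, hν, mul_one, Real.norm_of_nonneg ht.1.le]
        exact ht.2
      _ = r := by ring

/-- S is parametrized by the hyperplane orthogonal to ν. Since the segments stay in Ω, they may be
enlarged to full lines cut off by the indicator of Ω; translation by g z then straightens the graph,
and Fubini gives the integral over Ω. -/
theorem lintegral_graph_le {m : ℕ} {Ω : Set (E (m + 1))} (hΩ : IsOpen Ω) {ν : E (m + 1)}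
    (hν : ‖ν‖ = 1) {K : NNReal} {g : E (m + 1) → ℝ} (hg : LipschitzWith K g)
    (hinv : ∀ (x : E (m + 1)) (t : ℝ), g (x + t • ν) = g x) {S : Set (E (m + 1))}
    (hS : MeasurableSet S) (hSg : ∀ x ∈ S, g x = ⟪x, ν⟫_ℝ) {δ : ℝ}
    (hSΩ : ∀ x ∈ S, ∀ t ∈ Set.Ioo 0 δ, x + t • ν ∈ Ω) {f : E (m + 1) → ENNReal}
    (hf : Measurable f) :
    ∫⁻ y in S, (∫⁻ t in Set.Ioo 0 δ, f (y + t • ν)) ∂(Measure.euclideanHausdorffMeasure m) ≤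
      ((1 + K) ^ m : NNReal) * ∫⁻ x in Ω, f x := by
  have hF : Measurable (Ω.indicator f) := hf.indicator hΩ.measurableSet
  have hF2 : Measurable fun y : E (m + 1) => ∫⁻ t : ℝ, Ω.indicator f (y + t • ν) := by
    refine Measurable.lintegral_prod_right' (f := fun q : E (m + 1) × ℝ =>
      Ω.indicator f (q.1 + q.2 • ν)) (hF.comp ?_)
    fun_prop
  have hgr := euclideanHausdorffMeasure_restrict_graph_le (m := m) (by simp) hν hg hinv hSg
  have hΦ : Measurable (fun z : (ℝ ∙ ν)ᗮ => (z : E (m + 1)) + g z • ν) :=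
    (continuous_subtype_val.add
      ((hg.continuous.comp continuous_subtype_val).smul continuous_const)).measurable
  calc ∫⁻ y in S, (∫⁻ t in Set.Ioo 0 δ, f (y + t • ν)) ∂(Measure.euclideanHausdorffMeasure m)
      ≤ ∫⁻ y in S, (∫⁻ t : ℝ, Ω.indicator f (y + t • ν))
          ∂(Measure.euclideanHausdorffMeasure m) := by
        refine setLIntegral_mono' hS fun y hy => ?_
        rw [← lintegral_indicator measurableSet_Ioo]
        refine lintegral_mono fun t => ?_
        by_cases ht : t ∈ Set.Ioo 0 δ
        · rw [Set.indicator_of_mem ht, Set.indicator_of_mem (hSΩ y hy t ht)]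
        · rw [Set.indicator_of_notMem ht]
          exact bot_le
    _ ≤ ((1 + K) ^ m : NNReal) * ∫⁻ z : (ℝ ∙ ν)ᗮ, ∫⁻ t : ℝ,
          Ω.indicator f ((z + g z • ν) + t • ν) := by
        refine (lintegral_mono' hgr le_rfl).trans ?_
        rw [lintegral_smul_measure, lintegral_map hF2 hΦ, ENNReal.smul_def, smul_eq_mul]
    _ = ((1 + K) ^ m : NNReal) * ∫⁻ z : (ℝ ∙ ν)ᗮ, ∫⁻ t : ℝ, Ω.indicator f (z + t • ν) := by
        congr 1
        refine lintegral_congr fun z => ?_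
        rw [← lintegral_add_left_eq_self (fun t => Ω.indicator f (z + t • ν)) (g z)]
        simp only [add_smul, add_assoc]
    _ = ((1 + K) ^ m : NNReal) * ∫⁻ x in Ω, f x := by
        rw [lintegral_add_smul_unit hν hF, lintegral_indicator hΩ.measurableSet]

theorem exists_trace_inequality_near {m : ℕ} {Ω : Set (E (m + 1))}
    (hΩ : IsBoundedLipschitzDomain Ω) {p : E (m + 1)} (hp : p ∈ frontier Ω) :
    ∃ r : ℝ, 0 < r ∧ ∃ C : NNReal, ∀ φ : E (m + 1) → ℝ, ContDiff ℝ 1 φ →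
      ∫⁻ y in frontier Ω ∩ Metric.ball p r, ‖φ y‖ₑ ^ 2 ∂(Measure.euclideanHausdorffMeasure m) ≤
        C * ∫⁻ x in Ω, (‖φ x‖ₑ ^ 2 + ‖gradient φ x‖ₑ ^ 2) := by
  obtain ⟨r, ν, K, g, hr, hν, hg, hinv, h⟩ := hΩ.graph p hp
  set δ := r / 2 with hδ
  have hδ0 : 0 < δ := by positivity
  set S := frontier Ω ∩ Metric.ball p δ with hSdef
  have hS : MeasurableSet S := isClosed_frontier.measurableSet.inter measurableSet_ball
  -- Boundary points are not below the graph, being in the closure, and not above it, since Ω is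
  -- open and misses its frontier.
  have hSg : ∀ x ∈ S, g x = ⟪x, ν⟫_ℝ := by
    rintro x ⟨hx1, hx2⟩
    have hx3 : x ∈ Metric.ball p r := Metric.ball_subset_ball (by linarith) hx2
    refine le_antisymm
      (le_inner_of_mem_closure hg.continuous h (frontier_subset_closure hx1) hx3) ?_
    refine not_lt.1 fun hlt => ?_
    have hxΩ := (h x hx3).2 hlt
    rw [hΩ.isOpen.frontier_eq] at hx1
    exact hx1.2 hxΩ
  have hSΩ : ∀ x ∈ S, ∀ t ∈ Set.Ioo 0 δ, x + t • ν ∈ Ω := fun x hx t ht =>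
    add_smul_mem_of_mem_closure hν hg.continuous hinv h (frontier_subset_closure hx.1) hx.2 ht
  set D := ENNReal.ofReal δ with hD
  have hD0 : D ≠ 0 := by simpa [hD] using hδ0
  have hDt : D ≠ ⊤ := ENNReal.ofReal_ne_top
  set L : ENNReal := (((1 + K) ^ m : NNReal) : ENNReal) with hL
  have hCt : D⁻¹ * (2 + 2 * D ^ 2) * L ≠ ⊤ :=
    ENNReal.mul_ne_top (ENNReal.mul_ne_top (ENNReal.inv_ne_top.2 hD0)
      (ENNReal.add_ne_top.2 ⟨by simp, ENNReal.mul_ne_top (by simp) (ENNReal.pow_ne_top hDt)⟩))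
      ENNReal.coe_ne_top
  -- L is the graph constant; 2 and 2δ² are the coefficients of the segment estimate, whose left
  -- side carries the factor δ.
  refine ⟨δ, hδ0, (D⁻¹ * (2 + 2 * D ^ 2) * L).toNNReal, fun φ hφ => ?_⟩
  rw [ENNReal.coe_toNNReal hCt]
  have hm1 : Measurable fun x => ‖φ x‖ₑ ^ 2 := hφ.continuous.measurable.enorm.pow_const 2
  have hgc : Continuous (gradient φ) :=
    (InnerProductSpace.toDual ℝ (E (m + 1))).symm.continuous.comp (hφ.continuous_fderiv (by simp))
  have hm2 : Measurable fun x => ‖gradient φ x‖ₑ ^ 2 := hgc.measurable.enorm.pow_const 2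
  have k1 := lintegral_graph_le hΩ.isOpen hν hg hinv hS hSg hSΩ hm1
  have k2 := lintegral_graph_le hΩ.isOpen hν hg hinv hS hSg hSΩ hm2
  have hmm : Measurable fun y : E (m + 1) => ∫⁻ t in Set.Ioo 0 δ, ‖φ (y + t • ν)‖ₑ ^ 2 := by
    refine Measurable.lintegral_prod_right' (f := fun q : E (m + 1) × ℝ =>
      ‖φ (q.1 + q.2 • ν)‖ₑ ^ 2) (hm1.comp ?_)
    fun_prop
  have k : D * ∫⁻ y in S, ‖φ y‖ₑ ^ 2 ∂(Measure.euclideanHausdorffMeasure m) ≤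
      2 * (L * ∫⁻ x in Ω, ‖φ x‖ₑ ^ 2) + 2 * D ^ 2 * (L * ∫⁻ x in Ω, ‖gradient φ x‖ₑ ^ 2) := by
    rw [← lintegral_const_mul' _ _ hDt]
    refine (lintegral_mono fun y => enorm_sq_le_lintegral hφ hν y).trans ?_
    rw [lintegral_add_left (hmm.const_mul 2), lintegral_const_mul' _ _ (by simp),
      lintegral_const_mul' _ _ (ENNReal.mul_ne_top (by simp) (ENNReal.pow_ne_top hDt))]
    gcongr
  rw [lintegral_add_left hm1]
  calc ∫⁻ y in S, ‖φ y‖ₑ ^ 2 ∂(Measure.euclideanHausdorffMeasure m)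
      = D⁻¹ * (D * ∫⁻ y in S, ‖φ y‖ₑ ^ 2 ∂(Measure.euclideanHausdorffMeasure m)) := by
        rw [← mul_assoc, ENNReal.inv_mul_cancel hD0 hDt, one_mul]
    _ ≤ D⁻¹ * (2 * (L * ∫⁻ x in Ω, ‖φ x‖ₑ ^ 2) +
          2 * D ^ 2 * (L * ∫⁻ x in Ω, ‖gradient φ x‖ₑ ^ 2)) := by gcongr
    _ ≤ D⁻¹ * ((2 + 2 * D ^ 2) * (L * ∫⁻ x in Ω, ‖φ x‖ₑ ^ 2) +
          (2 + 2 * D ^ 2) * (L * ∫⁻ x in Ω, ‖gradient φ x‖ₑ ^ 2)) := by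
        gcongr
        · exact le_self_add
        · exact le_add_self
    _ = _ := by ring

/-- The local estimate passes to subsets and, adding constants, to finite unions, so compactness of
the boundary makes it global. -/
theorem exists_trace_inequality {m : ℕ} {Ω : Set (E (m + 1))} (hΩ : IsBoundedLipschitzDomain Ω) :
    ∃ C : NNReal, ∀ φ : E (m + 1) → ℝ, ContDiff ℝ 1 φ →
      ∫⁻ y, ‖φ y‖ₑ ^ 2 ∂(surf Ω) ≤ C * ∫⁻ x in Ω, (‖φ x‖ₑ ^ 2 + ‖gradient φ x‖ₑ ^ 2) := by
  have hc : IsCompact (frontier Ω) :=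
    Metric.isCompact_of_isClosed_isBounded isClosed_frontier
      (hΩ.isBounded.closure.subset frontier_subset_closure)
  refine hc.induction_on (p := fun s => ∃ C : NNReal, ∀ φ : E (m + 1) → ℝ, ContDiff ℝ 1 φ →
      ∫⁻ y in s, ‖φ y‖ₑ ^ 2 ∂(Measure.euclideanHausdorffMeasure m) ≤
        C * ∫⁻ x in Ω, (‖φ x‖ₑ ^ 2 + ‖gradient φ x‖ₑ ^ 2)) ?_ ?_ ?_ ?_
  · exact ⟨0, fun φ _ => by simp⟩
  · rintro s t hst ⟨C, hC⟩
    exact ⟨C, fun φ hφ => (lintegral_mono_set hst).trans (hC φ hφ)⟩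
  · rintro s t ⟨C, hC⟩ ⟨C', hC'⟩
    refine ⟨C + C', fun φ hφ => (lintegral_union_le _ _ _).trans ?_⟩
    rw [ENNReal.coe_add, add_mul]
    exact add_le_add (hC φ hφ) (hC' φ hφ)
  · intro p hp
    obtain ⟨r, hr, C, hC⟩ := exists_trace_inequality_near hΩ hp
    exact ⟨frontier Ω ∩ Metric.ball p r, inter_mem self_mem_nhdsWithin
      (mem_nhdsWithin_of_mem_nhds (Metric.ball_mem_nhds p hr)), C, hC⟩

/-- The trace inequality for the constant 1 bounds the surface area by a multiple of the volume.
Finiteness is what makes Fubini available on Ω × Γ. -/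
theorem isFiniteMeasure_surf {m : ℕ} {Ω : Set (E (m + 1))} (hΩ : IsBoundedLipschitzDomain Ω) :
    IsFiniteMeasure (surf Ω) := by
  obtain ⟨C, hC⟩ := exists_trace_inequality hΩ
  have h := hC (fun _ => 1) contDiff_const
  have hgr : ∀ x : E (m + 1), gradient (fun _ : E (m + 1) => (1 : ℝ)) x = 0 := fun x => by
    simp [gradient]
  simp only [hgr, enorm_one, one_pow, enorm_zero, lintegral_const, one_mul, ne_eq, two_ne_zero,
    not_false_eq_true, zero_pow, add_zero, Measure.restrict_apply MeasurableSet.univ,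
    Set.univ_inter] at h
  refine ⟨?_⟩
  rw [Measure.restrict_apply MeasurableSet.univ, Set.univ_inter]
  exact h.trans_lt (ENNReal.mul_lt_top ENNReal.coe_lt_top hΩ.isBounded.measure_lt_top)

/-! ### L² convergence of mollifications -/

section Mollification

open scoped Convolution

variable {P F : Type*} [NormedAddCommGroup P] [NormedSpace ℝ P] [FiniteDimensional ℝ P]
  [MeasurableSpace P] [BorelSpace P] {μ : Measure P} [μ.IsAddHaarMeasure]
  [NormedAddCommGroup F] [NormedSpace ℝ F]

-- Translations act continuously on L²; this is continuity at z = 0.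
omit [NormedSpace ℝ F] in
theorem exists_eLpNorm_translate_sub_le {f : P → F} (hf : MemLp f 2 μ) {ε : ENNReal}
    (hε : 0 < ε) :
    ∃ r > 0, ∀ z : P, ‖z‖ < r → eLpNorm (fun x => f (x - z) - f x) 2 μ ≤ ε := by
  let T : C(P, C(P, P)) := ContinuousMap.curry ⟨fun q : P × P => q.2 - q.1, by fun_prop⟩
  have hT : ∀ z, MeasurePreserving (T z) μ μ := fun z => measurePreserving_sub_right μ z
  have hc : Continuous fun z : P => Lp.compMeasurePreserving (T z) (hT z) (hf.toLp f) :=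
    Continuous.compMeasurePreservingLp continuous_const T.continuous hT (by simp)
  have h0 := hc.tendsto 0
  rw [EMetric.tendsto_nhds_nhds] at h0
  obtain ⟨δ, hδ, h⟩ := h0 ε hε
  obtain ⟨r, hr, hrδ⟩ : ∃ r : ℝ, 0 < r ∧ ENNReal.ofReal r ≤ δ := by
    rcases eq_or_ne δ ⊤ with rfl | ht
    · exact ⟨1, one_pos, le_top⟩
    · exact ⟨δ.toReal, ENNReal.toReal_pos hδ.ne' ht, ENNReal.ofReal_toReal_le⟩
  refine ⟨r, hr, fun z hz => ?_⟩
  have k := (h (x := z) ?_).le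
  · rw [Lp.edist_def] at k
    refine le_trans (le_of_eq (eLpNorm_congr_ae ?_)) k
    have e1 := Lp.coeFn_compMeasurePreserving (hf.toLp f) (hT z)
    have e2 := Lp.coeFn_compMeasurePreserving (hf.toLp f) (hT 0)
    have e3 := (hT z).quasiMeasurePreserving.ae_eq_comp hf.coeFn_toLp
    have e4 := (hT 0).quasiMeasurePreserving.ae_eq_comp hf.coeFn_toLp
    filter_upwards [e1, e2, e3, e4] with x h1 h2 h3 h4
    rw [Pi.sub_apply, h1, h2, h3, h4]
    simp [T]
  · refine lt_of_lt_of_le ?_ hrδ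
    rw [edist_zero_right, ← ofReal_norm]
    exact (ENNReal.ofReal_lt_ofReal_iff hr).2 hz

/-- Jensen's inequality for a weight of mass at most 1, from Cauchy–Schwarz with the splitting √ρ ·
(√ρ ‖h‖). -/
theorem lintegral_enorm_smul_sq_le {α : Type*} [MeasurableSpace α] {μ : Measure α} {ρ : α → ℝ}
    (hρ : AEStronglyMeasurable ρ μ)
    (h0 : ∀ x, 0 ≤ ρ x) (h1 : ∫⁻ x, ‖ρ x‖ₑ ∂μ ≤ 1) {h : α → F} (hh : AEStronglyMeasurable h μ) :
    (∫⁻ x, ‖ρ x • h x‖ₑ ∂μ) ^ 2 ≤ ∫⁻ x, ‖ρ x‖ₑ * ‖h x‖ₑ ^ 2 ∂μ := by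
  have hs : AEStronglyMeasurable (fun x => √(ρ x)) μ :=
    Real.continuous_sqrt.comp_aestronglyMeasurable hρ
  have hsq : ∀ x, ‖√(ρ x)‖ₑ ^ 2 = ‖ρ x‖ₑ := fun x => by
    rw [← enorm_pow, Real.sq_sqrt (h0 x)]
  have k := lintegral_enorm_mul_le hs (hs.mul hh.norm)
  have e : ∀ x, ‖√(ρ x) * ((fun x => √(ρ x)) * fun x => ‖h x‖) x‖ₑ = ‖ρ x • h x‖ₑ := fun x => by
    rw [Pi.mul_apply, ← mul_assoc, Real.mul_self_sqrt (h0 x), enorm_mul, enorm_norm, enorm_smul]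
  simp only [e] at k
  refine (pow_le_pow_left₀ bot_le k 2).trans ?_
  rw [mul_pow, eLpNorm_two_sq, eLpNorm_two_sq]
  simp only [hsq, Pi.mul_apply, enorm_mul, mul_pow, enorm_norm]
  exact (mul_le_mul_left h1 _).trans (one_mul _).le

variable [CompleteSpace F]

/-- The error is a ρ-average of translation errors, by Jensen and Tonelli. The kernel need only live
near the origin, not be centred there, so kernels that also shift are covered. -/
theorem exists_eLpNorm_convolution_sub_le {f : P → F} (hf : MemLp f 2 μ) {ε : ENNReal}
    (hε : 0 < ε) :
    ∃ r > 0, ∀ ρ : P → ℝ, Continuous ρ → HasCompactSupport ρ → (∀ x, 0 ≤ ρ x) →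
      ∫ x, ρ x ∂μ = 1 → (∀ x, r ≤ ‖x‖ → ρ x = 0) →
      eLpNorm (fun x => (ρ ⋆[ContinuousLinearMap.lsmul ℝ ℝ, μ] f) x - f x) 2 μ ≤ ε := by
  obtain ⟨r, hr, h⟩ := exists_eLpNorm_translate_sub_le hf hε
  refine ⟨r, hr, fun ρ hc hs h0 h1 hz => ?_⟩
  have hρi : Integrable ρ μ := hc.integrable_of_hasCompactSupport hs
  have hl : ∫⁻ x, ‖ρ x‖ₑ ∂μ = 1 := by
    have := ofReal_integral_eq_lintegral_ofReal hρi (ae_of_all _ h0)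
    rw [h1, ENNReal.ofReal_one] at this
    rw [this]
    exact lintegral_congr fun x => Real.enorm_of_nonneg (h0 x)
  have hint : ∀ x, Integrable (fun t => ρ t • f (x - t)) μ := fun x =>
    (hs.convolutionExists_left (ContinuousLinearMap.lsmul ℝ ℝ) hc
      (hf.locallyIntegrable (by norm_num))) x
  have hm2 : AEStronglyMeasurable (fun q : P × P => f (q.1 - q.2) - f q.1) (μ.prod μ) :=
    (hf.1.comp_quasiMeasurePreserving (quasiMeasurePreserving_sub_of_right_invariant μ μ)).sub
      hf.1.comp_fst
  have hp : ∀ᵐ x ∂μ, ‖(ρ ⋆[ContinuousLinearMap.lsmul ℝ ℝ, μ] f) x - f x‖ₑ ^ 2 ≤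
      ∫⁻ t, ‖ρ t‖ₑ * ‖f (x - t) - f x‖ₑ ^ 2 ∂μ := by
    filter_upwards [hm2.prodMk_left] with x hx
    have e : (ρ ⋆[ContinuousLinearMap.lsmul ℝ ℝ, μ] f) x - f x =
        ∫ t, ρ t • (f (x - t) - f x) ∂μ := by
      simp only [smul_sub]
      rw [integral_sub (hint x) (hρi.smul_const _), integral_smul_const, h1, one_smul]
      rfl
    rw [e]
    exact (pow_le_pow_left₀ bot_le (enorm_integral_le_lintegral_enorm _) 2).trans
      (lintegral_enorm_smul_sq_le hc.aestronglyMeasurable h0 hl.le hx)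
  rw [← ENNReal.pow_le_pow_left_iff two_ne_zero, eLpNorm_two_sq]
  refine (lintegral_mono_ae hp).trans ?_
  rw [lintegral_lintegral_swap]
  · calc ∫⁻ t, ∫⁻ x, ‖ρ t‖ₑ * ‖f (x - t) - f x‖ₑ ^ 2 ∂μ ∂μ
        ≤ ∫⁻ t, ‖ρ t‖ₑ * ε ^ 2 ∂μ := by
          refine lintegral_mono fun t => ?_
          rw [lintegral_const_mul' _ _ (by simp), ← eLpNorm_two_sq]
          by_cases ht : r ≤ ‖t‖
          · simp [hz t ht]
          · gcongr
            exact h t (not_le.1 ht)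
      _ = ε ^ 2 := by
          rw [lintegral_mul_const _ hc.measurable.enorm, hl, one_mul]
  · exact (hc.aestronglyMeasurable.comp_snd.enorm).mul (hm2.enorm.pow_const 2)

end Mollification

/-! ### Partial weak gradients and shifted mollification -/

section PartialGradient

open scoped Convolution

variable {P V : Type*} [NormedAddCommGroup P] [NormedSpace ℝ P]
  [NormedAddCommGroup V] [InnerProductSpace ℝ V] [CompleteSpace V]

/-- The gradient of `ψ` along the directions in the range of `j`. -/
noncomputable def pgrad (j : V →L[ℝ] P) (ψ : P → ℝ) (p : P) : V :=
  (InnerProductSpace.toDual ℝ V).symm ((fderiv ℝ ψ p).comp j)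

theorem inner_pgrad (j : V →L[ℝ] P) (ψ : P → ℝ) (p : P) (v : V) :
    ⟪pgrad j ψ p, v⟫_ℝ = fderiv ℝ ψ p (j v) := by
  simp [pgrad, InnerProductSpace.toDual_symm_apply]

theorem continuous_pgrad (j : V →L[ℝ] P) {ψ : P → ℝ} (hψ : ContDiff ℝ 1 ψ) :
    Continuous (pgrad j ψ) :=
  (InnerProductSpace.toDual ℝ V).symm.continuous.comp
    ((hψ.continuous_fderiv (by simp)).clm_comp continuous_const)

variable [MeasurableSpace P]

/-- `h` is the weak gradient of `u` on `U` along the directions in the range of `j`. -/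
def IsWeakPGrad (μ : Measure P) (U : Set P) (j : V →L[ℝ] P) (u : P → ℝ) (h : P → V) : Prop :=
  ∀ φ : P → ℝ, ContDiff ℝ ∞ φ → HasCompactSupport φ → tsupport φ ⊆ U → ∀ v : V,
    ∫ p in U, u p * fderiv ℝ φ p (j v) ∂μ = -∫ p in U, φ p * ⟪h p, v⟫_ℝ ∂μ

variable [FiniteDimensional ℝ P] [BorelSpace P] {μ : Measure P} [μ.IsAddHaarMeasure]

/-- The derivative falls on ρ, and y ↦ ρ (x − y) is an admissible test function because its support
lies in U. The sign from reflecting ρ cancels the sign in the weak-gradient identity; the cut-off by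
the indicator is invisible at such x. -/
theorem pgrad_convolution {U : Set P} (hU : IsOpen U) {j : V →L[ℝ] P} {u : P → ℝ} {h : P → V}
    (hu : MemLp u 2 (μ.restrict U)) (hh : MemLp h 2 (μ.restrict U)) (hw : IsWeakPGrad μ U j u h)
    {ρ : P → ℝ} (hρ : ContDiff ℝ ∞ ρ) (hc : HasCompactSupport ρ) {x : P}
    (hx : tsupport (fun y => ρ (x - y)) ⊆ U) :
    pgrad j (ρ ⋆[ContinuousLinearMap.lsmul ℝ ℝ, μ] U.indicator u) x =
      (ρ ⋆[ContinuousLinearMap.lsmul ℝ ℝ, μ] U.indicator h) x := by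
  have hu' : LocallyIntegrable (U.indicator u) μ :=
    ((memLp_indicator_iff_restrict hU.measurableSet).2 hu).locallyIntegrable (by norm_num)
  have hh' : LocallyIntegrable (U.indicator h) μ :=
    ((memLp_indicator_iff_restrict hU.measurableSet).2 hh).locallyIntegrable (by norm_num)
  refine ext_inner_right ℝ fun v => ?_
  have e1 : fderiv ℝ (ρ ⋆[ContinuousLinearMap.lsmul ℝ ℝ, μ] U.indicator u) x (j v) =
      ∫ y, (fderiv ℝ ρ (x - y) (j v)) * U.indicator u y ∂μ := by
    rw [(hc.hasFDerivAt_convolution_left (ContinuousLinearMap.lsmul ℝ ℝ)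
      (hρ.of_le (by simp)) hu' x).fderiv]
    have hi := (hc.fderiv (𝕜 := ℝ)).convolutionExists_left
      ((ContinuousLinearMap.lsmul ℝ ℝ : ℝ →L[ℝ] ℝ →L[ℝ] ℝ).precompL P)
      (hρ.continuous_fderiv (by simp)) hu' x
    rw [convolution, ContinuousLinearMap.integral_apply hi,
      ← integral_sub_left_eq_self (fun t => _) μ x]
    refine integral_congr_ae (ae_of_all _ fun y => ?_)
    simp
  have hφ : ContDiff ℝ ∞ (fun y => ρ (x - y)) := hρ.comp (contDiff_const.sub contDiff_id)
  have hφc : HasCompactSupport (fun y => ρ (x - y)) := hc.comp_homeomorph (Homeomorph.subLeft x)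
  have e2 : ∀ y, fderiv ℝ (fun y => ρ (x - y)) y (j v) = -fderiv ℝ ρ (x - y) (j v) := fun y => by
    have h1 : HasFDerivAt ρ (fderiv ℝ ρ (x - y)) (x - y) :=
      ((hρ.differentiable (by simp)) _).hasFDerivAt
    have h2 := h1.comp y ((hasFDerivAt_id y).const_sub x)
    rw [HasFDerivAt.fderiv (f := fun y => ρ (x - y)) h2]
    simp
  have e3 : ∫ y, (fderiv ℝ ρ (x - y) (j v)) * U.indicator u y ∂μ =
      ∫ y in U, ρ (x - y) * ⟪h y, v⟫_ℝ ∂μ := by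
    have k := hw _ hφ hφc hx v
    rw [← neg_eq_iff_eq_neg] at k
    rw [← k, ← integral_neg, ← integral_indicator hU.measurableSet]
    refine integral_congr_ae (ae_of_all _ fun y => ?_)
    by_cases hy : y ∈ U
    · simp only [Set.indicator_of_mem hy, e2]
      ring
    · simp only [Set.indicator_of_notMem hy, mul_zero]
  have e4 : ⟪(ρ ⋆[ContinuousLinearMap.lsmul ℝ ℝ, μ] U.indicator h) x, v⟫_ℝ =
      ∫ y in U, ρ (x - y) * ⟪h y, v⟫_ℝ ∂μ := by
    have hi := hc.convolutionExists_left (ContinuousLinearMap.lsmul ℝ ℝ) hρ.continuous hh' x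
    rw [convolution_eq_swap, real_inner_comm, ← integral_inner, ← integral_indicator
      hU.measurableSet]
    · refine integral_congr_ae (ae_of_all _ fun y => ?_)
      by_cases hy : y ∈ U
      · simp only [Set.indicator_of_mem hy, ContinuousLinearMap.lsmul_apply, real_inner_smul_right,
          real_inner_comm]
      · simp only [Set.indicator_of_notMem hy, ContinuousLinearMap.lsmul_apply, smul_zero,
          inner_zero_right]
    · exact hi.integrable_swap
  rw [inner_pgrad, e1, e3, e4]

omit [NormedAddCommGroup P] [NormedSpace ℝ P] [FiniteDimensional ℝ P] [BorelSpace P]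
  [μ.IsAddHaarMeasure] in
theorem eLpNorm_restrict_sub_le {F : Type*} [NormedAddCommGroup F] {S : Set P}
    (hS : MeasurableSet S) {f g f' g' : P → F} {ε : ENNReal}
    (h : eLpNorm (fun x => f' x - g' x) 2 μ ≤ ε) (hf : ∀ x ∈ S, f x = f' x)
    (hg : ∀ x ∈ S, g x = g' x) : eLpNorm (fun x => f x - g x) 2 (μ.restrict S) ≤ ε := by
  refine le_trans (le_of_eq (eLpNorm_congr_ae ?_)) ((eLpNorm_mono_measure _
    (Measure.restrict_le_self (s := S))).trans h)
  filter_upwards [ae_restrict_mem hS] with x hx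
  rw [hf x hx, hg x hx]

/-- One convolution shifts and mollifies: with a kernel centred at −tη, the value at x ∈ K averages
u near x + tη, which is inside U even when x is on its boundary. A single kernel serves u and both
gradients. -/
theorem exists_approx_of_translate {U K : Set P} (hU : IsOpen U) (hK : IsCompact K) {η : P}
    {t₀ : ℝ} (ht₀ : 0 < t₀) (hη : ∀ x ∈ K, ∀ t ∈ Set.Ioo 0 t₀, x + t • η ∈ U)
    {j₁ j₂ : V →L[ℝ] P} {u : P → ℝ} {h₁ h₂ : P → V} (hu : MemLp u 2 (μ.restrict U))
    (hh₁ : MemLp h₁ 2 (μ.restrict U)) (hh₂ : MemLp h₂ 2 (μ.restrict U))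
    (hw₁ : IsWeakPGrad μ U j₁ u h₁) (hw₂ : IsWeakPGrad μ U j₂ u h₂) {ε : ENNReal} (hε : 0 < ε) :
    ∃ ψ : P → ℝ, ContDiff ℝ ∞ ψ ∧
      eLpNorm (fun x => ψ x - u x) 2 (μ.restrict (K ∩ U)) ≤ ε ∧
      eLpNorm (fun x => pgrad j₁ ψ x - h₁ x) 2 (μ.restrict (K ∩ U)) ≤ ε ∧
      eLpNorm (fun x => pgrad j₂ ψ x - h₂ x) 2 (μ.restrict (K ∩ U)) ≤ ε := by
  have hu' := (memLp_indicator_iff_restrict hU.measurableSet).2 hu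
  have hh₁' := (memLp_indicator_iff_restrict hU.measurableSet).2 hh₁
  have hh₂' := (memLp_indicator_iff_restrict hU.measurableSet).2 hh₂
  obtain ⟨r, hr, H⟩ := exists_eLpNorm_convolution_sub_le hu' hε
  obtain ⟨r₁, hr₁, H₁⟩ := exists_eLpNorm_convolution_sub_le hh₁' hε
  obtain ⟨r₂, hr₂, H₂⟩ := exists_eLpNorm_convolution_sub_le hh₂' hε
  set s := min r (min r₁ r₂) with hs
  have hs0 : 0 < s := lt_min hr (lt_min hr₁ hr₂)
  obtain ⟨t, ht, htη⟩ : ∃ t ∈ Set.Ioo 0 t₀, t * ‖η‖ < s / 2 := by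
    have hl : Tendsto (fun t : ℝ => t * ‖η‖) (𝓝[>] 0) (𝓝 0) := by
      have : Tendsto (fun t : ℝ => t * ‖η‖) (𝓝 0) (𝓝 (0 * ‖η‖)) :=
        (continuous_id.mul continuous_const).tendsto 0
      rw [zero_mul] at this
      exact this.mono_left nhdsWithin_le_nhds
    have hI : ∀ᶠ t in 𝓝[>] (0 : ℝ), t ∈ Set.Ioo 0 t₀ := Ioo_mem_nhdsGT ht₀
    exact (hI.and (hl.eventually (gt_mem_nhds (half_pos hs0)))).exists
  -- Compactness of the shifted set gives a uniform margin δ inside U.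
  have hKt : IsCompact ((fun x => x + t • η) '' K) := hK.image (by fun_prop)
  obtain ⟨δ, hδ, hδU⟩ := hKt.exists_cthickening_subset_open hU
    (by rintro _ ⟨x, hx, rfl⟩; exact hη x hx t ht)
  -- The bound δ keeps the averages inside U; s/2, added to ‖t η‖ < s/2, keeps the kernel within
  -- distance s of the origin.
  set δ' := min δ (s / 2) with hδ'
  have hδ'0 : 0 < δ' := lt_min hδ (half_pos hs0)
  let b : ContDiffBump (-(t • η)) := ⟨δ' / 2, δ', half_pos hδ'0, half_lt_self hδ'0⟩
  set ρ : P → ℝ := b.normed μ with hρ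
  have hρs : ContDiff ℝ ∞ ρ := b.contDiff_normed
  have hρc : HasCompactSupport ρ := b.hasCompactSupport_normed
  have hρ0 : ∀ x, 0 ≤ ρ x := b.nonneg_normed
  have hρ1 : ∫ x, ρ x ∂μ = 1 := b.integral_normed
  have hρz : ∀ x, s ≤ ‖x‖ → ρ x = 0 := by
    intro x hx
    by_contra hne
    have : x ∈ Function.support (b.normed μ) := hne
    rw [b.support_normed_eq, mem_ball_iff_norm, sub_neg_eq_add] at this
    have h1 : ‖x‖ ≤ ‖x + t • η‖ + ‖t • η‖ := by
      simpa using norm_sub_le (x + t • η) (t • η)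
    rw [norm_smul, Real.norm_of_nonneg ht.1.le] at h1
    have h2 : δ' ≤ s / 2 := min_le_right _ _
    change ‖x + t • η‖ < δ' at this
    linarith
  have hsup : ∀ x ∈ K, tsupport (fun y => ρ (x - y)) ⊆ U := by
    intro x hx
    refine (closure_minimal ?_ Metric.isClosed_closedBall).trans
      ((Metric.closedBall_subset_cthickening (Set.mem_image_of_mem _ hx) δ).trans hδU)
    intro y hy
    have : x - y ∈ Function.support (b.normed μ) := hy
    rw [b.support_normed_eq, mem_ball_iff_norm] at this
    rw [mem_closedBall_iff_norm']
    have e : x - y - -(t • η) = x + t • η - y := by abel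
    rw [e] at this
    exact this.le.trans (min_le_left _ _)
  have hKm : MeasurableSet (K ∩ U) := hK.measurableSet.inter hU.measurableSet
  refine ⟨ρ ⋆[ContinuousLinearMap.lsmul ℝ ℝ, μ] U.indicator u,
    hρc.contDiff_convolution_left _ hρs (hu'.locallyIntegrable (by norm_num)), ?_, ?_, ?_⟩
  · exact eLpNorm_restrict_sub_le hKm
      (H ρ hρs.continuous hρc hρ0 hρ1 fun x hx => hρz x ((min_le_left _ _).trans hx))
      (fun _ _ => rfl) (fun x hx => (Set.indicator_of_mem hx.2 _).symm)
  · exact eLpNorm_restrict_sub_le hKm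
      (H₁ ρ hρs.continuous hρc hρ0 hρ1 fun x hx =>
        hρz x (((min_le_right _ _).trans (min_le_left _ _)).trans hx))
      (fun x hx => pgrad_convolution hU hu hh₁ hw₁ hρs hρc (hsup x hx.1))
      (fun x hx => (Set.indicator_of_mem hx.2 _).symm)
  · exact eLpNorm_restrict_sub_le hKm
      (H₂ ρ hρs.continuous hρc hρ0 hρ1 fun x hx =>
        hρz x (((min_le_right _ _).trans (min_le_right _ _)).trans hx))
      (fun x hx => pgrad_convolution hU hu hh₂ hw₂ hρs hρc (hsup x hx.1))
      (fun x hx => (Set.indicator_of_mem hx.2 _).symm)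

end PartialGradient

/-! ### Global smooth approximation by a partition of unity -/

section Patching

open scoped Manifold

variable {P V : Type*} [NormedAddCommGroup P] [NormedSpace ℝ P]
  [NormedAddCommGroup V] [InnerProductSpace ℝ V] [CompleteSpace V]

theorem pgrad_sum_mul {ι : Type*} [Fintype ι] (j : V →L[ℝ] P) {χ ψ : ι → P → ℝ} {x : P}
    (hχ : ∀ i, DifferentiableAt ℝ (χ i) x) (hψ : ∀ i, DifferentiableAt ℝ (ψ i) x) :
    pgrad j (fun x => ∑ i, χ i x * ψ i x) x =
      ∑ i, (χ i x • pgrad j (ψ i) x + ψ i x • pgrad j (χ i) x) := by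
  refine ext_inner_right ℝ fun v => ?_
  rw [inner_pgrad, sum_inner, fderiv_fun_sum (A := fun i y => χ i y * ψ i y)
    fun i _ => (hχ i).mul (hψ i)]
  simp only [sum_apply, inner_add_left, real_inner_smul_left, inner_pgrad]
  refine Finset.sum_congr rfl fun i _ => ?_
  rw [fderiv_fun_mul (hχ i) (hψ i)]
  simp

theorem sum_pgrad_eq_zero {ι : Type*} [Fintype ι] (j : V →L[ℝ] P) {χ : ι → P → ℝ} {x : P}
    (hχ : ∀ i, DifferentiableAt ℝ (χ i) x) (h : ∀ᶠ y in 𝓝 x, ∑ i, χ i y = 1) :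
    ∑ i, pgrad j (χ i) x = 0 := by
  refine ext_inner_right ℝ fun v => ?_
  have e : fderiv ℝ (fun y => ∑ i, χ i y) x = 0 := by
    have : (fun y => ∑ i, χ i y) =ᶠ[𝓝 x] fun _ => 1 := h
    rw [this.fderiv_eq]
    simp
  rw [fderiv_fun_sum fun i _ => hχ i] at e
  rw [sum_inner, inner_zero_left]
  simp only [inner_pgrad]
  rw [← sum_apply, e]
  rfl

theorem norm_pgrad_le (j : V →L[ℝ] P) (ψ : P → ℝ) (x : P) :
    ‖pgrad j ψ x‖ ≤ ‖fderiv ℝ ψ x‖ * ‖j‖ := by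
  rw [pgrad, LinearIsometryEquiv.norm_map]
  exact ContinuousLinearMap.opNorm_comp_le _ _

theorem exists_smooth_partition_of_unity [FiniteDimensional ℝ P] {K : Set P} (hK : IsCompact K)
    {r : P → ℝ} (hr : ∀ p ∈ K, 0 < r p) :
    ∃ (t : Finset P) (χ : t → P → ℝ), (∀ i : t, (i : P) ∈ K) ∧ (∀ i, ContDiff ℝ ∞ (χ i)) ∧
      (∀ i x, ‖χ i x‖ ≤ 1) ∧ (∀ i, tsupport (χ i) ⊆ Metric.ball i (r i)) ∧
      ∀ x ∈ K, ∑ i, χ i x = 1 := by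
  obtain ⟨t, htK, ht⟩ := hK.elim_nhds_subcover (fun p => Metric.ball p (r p))
    fun p hp => Metric.ball_mem_nhds p (hr p hp)
  obtain ⟨f, hf⟩ := SmoothPartitionOfUnity.exists_isSubordinate 𝓘(ℝ, P) hK.isClosed
    (fun i : t => Metric.ball (i : P) (r i)) (fun _ => Metric.isOpen_ball)
    (fun x hx => by simpa using ht hx)
  refine ⟨t, fun i => f i, fun i => htK i i.2, fun i => (f i).contMDiff.contDiff, fun i x => ?_,
    hf, fun x hx => ?_⟩
  · rw [Real.norm_of_nonneg (f.nonneg i x)]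
    exact f.le_one i x
  · rw [← finsum_eq_sum_of_fintype]
    exact f.sum_eq_one hx

variable [MeasurableSpace P] [BorelSpace P] {μ : Measure P}

omit [NormedSpace ℝ P] in
theorem eLpNorm_restrict_le_of_bound {F G : Type*} [NormedAddCommGroup F] [NormedAddCommGroup G]
    {U K : Set P} (hK : IsClosed K) {a : P → F} {b : P → G} {c : NNReal}
    (hab : ∀ x, ‖a x‖ ≤ c * ‖b x‖) (h0 : ∀ x ∉ K, a x = 0) :
    eLpNorm a 2 (μ.restrict U) ≤ c * eLpNorm b 2 (μ.restrict (K ∩ U)) := by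
  have e : a = K.indicator a := by
    funext x
    by_cases hx : x ∈ K
    · rw [Set.indicator_of_mem hx]
    · rw [Set.indicator_of_notMem hx, h0 x hx]
  rw [e, eLpNorm_indicator_eq_eLpNorm_restrict hK.measurableSet,
    Measure.restrict_restrict hK.measurableSet]
  exact eLpNorm_le_nnreal_smul_eLpNorm_of_ae_le_mul (ae_of_all _ hab) 2

variable [FiniteDimensional ℝ P] [μ.IsAddHaarMeasure]

/-- Local approximants ψᵢ are glued with a partition of unity χᵢ. Since ∑ χᵢ = 1 and ∑ ∇χᵢ = 0 on U,
the gradient error is ∑ χᵢ (∇ψᵢ − h) + ∑ (ψᵢ − u) ∇χᵢ, so no product rule for weak gradients is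
needed. -/
theorem exists_contDiff_approx {U : Set P} (hU : IsOpen U) (hc : IsCompact (closure U))
    (hseg : ∀ p ∈ closure U, ∃ (r : ℝ) (η : P) (t₀ : ℝ), 0 < r ∧ 0 < t₀ ∧
      ∀ x ∈ closure U ∩ Metric.closedBall p r, ∀ t ∈ Set.Ioo 0 t₀, x + t • η ∈ U)
    {j₁ j₂ : V →L[ℝ] P} {u : P → ℝ} {h₁ h₂ : P → V} (hu : MemLp u 2 (μ.restrict U))
    (hh₁ : MemLp h₁ 2 (μ.restrict U)) (hh₂ : MemLp h₂ 2 (μ.restrict U))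
    (hw₁ : IsWeakPGrad μ U j₁ u h₁) (hw₂ : IsWeakPGrad μ U j₂ u h₂) {ε : ENNReal} (hε : 0 < ε) :
    ∃ ψ : P → ℝ, ContDiff ℝ ∞ ψ ∧
      eLpNorm (fun x => ψ x - u x) 2 (μ.restrict U) ≤ ε ∧
      eLpNorm (fun x => pgrad j₁ ψ x - h₁ x) 2 (μ.restrict U) ≤ ε ∧
      eLpNorm (fun x => pgrad j₂ ψ x - h₂ x) 2 (μ.restrict U) ≤ ε := by
  choose! r η t₀ hr ht₀ hη using hseg
  obtain ⟨t, χ, htK, hχ, hχ1, hχs, hχsum⟩ := exists_smooth_partition_of_unity hc hr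
  have hcs : ∀ i, HasCompactSupport (χ i) := fun i =>
    (isCompact_closedBall (i : P) (r i)).of_isClosed_subset (isClosed_tsupport _)
      ((hχs i).trans Metric.ball_subset_closedBall)
  choose M hM using fun i => ((hχ i).continuous_fderiv (by simp)).bounded_above_of_compact_support
    ((hcs i).fderiv (𝕜 := ℝ))
  obtain ⟨L, hL⟩ : ∃ L : NNReal, ∀ j : V →L[ℝ] P, (j = j₁ ∨ j = j₂) → ∀ i x,
      ‖pgrad j (χ i) x‖ ≤ L := by
    have hM0 : ∀ i, 0 ≤ M i := fun i => (norm_nonneg _).trans (hM i 0)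
    refine ⟨⟨(∑ i, M i) * (‖j₁‖ + ‖j₂‖), mul_nonneg (Finset.sum_nonneg fun i _ => hM0 i)
      (by positivity)⟩, fun j hj i x => (norm_pgrad_le j _ x).trans ?_⟩
    refine mul_le_mul ((hM i x).trans (Finset.single_le_sum (fun i _ => hM0 i)
      (Finset.mem_univ i))) ?_ (norm_nonneg _) (Finset.sum_nonneg fun i _ => hM0 i)
    rcases hj with rfl | rfl
    · exact le_add_of_nonneg_right (norm_nonneg _)
    · exact le_add_of_nonneg_left (norm_nonneg _)
  -- Each patch contributes at most (1 + L) ε'. The extra 1 keeps C nonzero when there are no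
  -- patches.
  set C : ENNReal := (t.card + 1) * (1 + L) with hC
  have hC0 : C ≠ 0 := by positivity
  have hCt : C ≠ ⊤ := ENNReal.mul_ne_top (by simp) (by simp)
  set ε' := ε / C with hε'
  have hε'0 : 0 < ε' := ENNReal.div_pos hε.ne' hCt
  set K : t → Set P := fun i => closure U ∩ Metric.closedBall i (r i) with hKdef
  have hKc : ∀ i, IsCompact (K i) := fun i => hc.inter_right Metric.isClosed_closedBall
  choose ψ hψ k0 k1 k2 using fun i : t => exists_approx_of_translate hU (hKc i)
    (ht₀ i (htK i)) (hη i (htK i)) hu hh₁ hh₂ hw₁ hw₂ hε'0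
  have hdχ : ∀ i x, DifferentiableAt ℝ (χ i) x := fun i x => (hχ i).differentiable (by simp) x
  have hdψ : ∀ i x, DifferentiableAt ℝ (ψ i) x := fun i x => (hψ i).differentiable (by simp) x
  have hUK : ∀ i : t, Metric.closedBall (i : P) (r i) ∩ U = K i ∩ U := fun i => by
    ext x
    simp only [hKdef, Set.mem_inter_iff]
    exact ⟨fun h => ⟨⟨subset_closure h.2, h.1⟩, h.2⟩, fun h => ⟨h.1.2, h.2⟩⟩
  have hχ0 : ∀ i : t, ∀ x ∉ Metric.closedBall (i : P) (r i), χ i x = 0 := fun i x hx =>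
    image_eq_zero_of_notMem_tsupport fun h => hx (Metric.ball_subset_closedBall (hχs i h))
  have hg0 : ∀ j : V →L[ℝ] P, ∀ i : t, ∀ x ∉ Metric.closedBall (i : P) (r i),
      pgrad j (χ i) x = 0 := fun j i x hx => by
    have : fderiv ℝ (χ i) x = 0 := image_eq_zero_of_notMem_tsupport fun h =>
      hx (Metric.ball_subset_closedBall (hχs i (tsupport_fderiv_subset ℝ h)))
    rw [pgrad, this, ContinuousLinearMap.zero_comp, map_zero]
  have hUm := hU.measurableSet
  have b0 : ∀ i, eLpNorm (fun x => χ i x * (ψ i x - u x)) 2 (μ.restrict U) ≤ ε' := fun i => by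
    have := eLpNorm_restrict_le_of_bound (μ := μ) (U := U) (K := Metric.closedBall (i : P) (r i))
      Metric.isClosed_closedBall (a := fun x => χ i x * (ψ i x - u x))
      (b := fun x => ψ i x - u x) (c := 1)
      (fun x => by
        rw [norm_mul]
        exact mul_le_mul_of_nonneg_right (hχ1 i x) (norm_nonneg _))
      (fun x hx => by simp only [hχ0 i x hx, zero_mul])
    rw [hUK] at this
    refine this.trans ?_
    rw [ENNReal.coe_one, one_mul]
    exact k0 i
  have hN : (t.card : ENNReal) * ((1 + L) * ε') ≤ ε := by
    calc (t.card : ENNReal) * ((1 + L) * ε') ≤ (t.card + 1) * ((1 + L) * ε') := by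
          gcongr; exact le_self_add
      _ = C * ε' := by rw [hC, mul_assoc]
      _ = ε := ENNReal.mul_div_cancel hC0 hCt
  have grad : ∀ (j : V →L[ℝ] P) (h : P → V), (j = j₁ ∨ j = j₂) → MemLp h 2 (μ.restrict U) →
      (∀ i, eLpNorm (fun x => pgrad j (ψ i) x - h x) 2 (μ.restrict (K i ∩ U)) ≤ ε') →
      eLpNorm (fun x => pgrad j (fun x => ∑ i, χ i x * ψ i x) x - h x) 2 (μ.restrict U) ≤ ε := by
    intro j h hj hh hk
    have m1 : ∀ i, AEStronglyMeasurable (fun x => χ i x • (pgrad j (ψ i) x - h x))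
        (μ.restrict U) := fun i =>
      (hχ i).continuous.aestronglyMeasurable.smul
        ((continuous_pgrad j ((hψ i).of_le (by simp))).aestronglyMeasurable.sub hh.1)
    have m2 : ∀ i, AEStronglyMeasurable (fun x => (ψ i x - u x) • pgrad j (χ i) x)
        (μ.restrict U) := fun i =>
      ((hψ i).continuous.aestronglyMeasurable.sub hu.1).smul
        (continuous_pgrad j ((hχ i).of_le (by simp))).aestronglyMeasurable
    have e : (fun x => pgrad j (fun x => ∑ i, χ i x * ψ i x) x - h x) =ᵐ[μ.restrict U]
        ∑ i, ((fun x => χ i x • (pgrad j (ψ i) x - h x)) +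
          fun x => (ψ i x - u x) • pgrad j (χ i) x) := by
      filter_upwards [ae_restrict_mem hUm] with x hx
      have s1 := hχsum x (subset_closure hx)
      have s2 : ∑ i, pgrad j (χ i) x = 0 := sum_pgrad_eq_zero j (fun i => hdχ i x)
        (by filter_upwards [hU.mem_nhds hx] with y hy using hχsum y (subset_closure hy))
      rw [pgrad_sum_mul j (fun i => hdχ i x) (fun i => hdψ i x), Finset.sum_apply]
      simp only [Pi.add_apply, smul_sub, sub_smul, Finset.sum_add_distrib, Finset.sum_sub_distrib]
      rw [← Finset.sum_smul, ← Finset.smul_sum, s1, s2, one_smul, smul_zero, sub_zero]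
      abel
    rw [eLpNorm_congr_ae e]
    refine (eLpNorm_sum_le (fun i _ => (m1 i).add (m2 i)) (by norm_num)).trans ?_
    refine (Finset.sum_le_card_nsmul _ _ ((1 + L) * ε') fun i _ => ?_).trans ?_
    · refine (eLpNorm_add_le (m1 i) (m2 i) (by norm_num)).trans ?_
      rw [add_mul, one_mul]
      refine add_le_add ?_ ?_
      · have := eLpNorm_restrict_le_of_bound (μ := μ) (U := U)
          (K := Metric.closedBall (i : P) (r i))
          Metric.isClosed_closedBall (a := fun x => χ i x • (pgrad j (ψ i) x - h x))
          (b := fun x => pgrad j (ψ i) x - h x) (c := 1)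
          (fun x => by
            rw [norm_smul]
            exact mul_le_mul_of_nonneg_right (hχ1 i x) (norm_nonneg _))
          (fun x hx => by simp only [hχ0 i x hx, zero_smul])
        rw [hUK] at this
        refine this.trans ?_
        rw [ENNReal.coe_one, one_mul]
        exact hk i
      · have := eLpNorm_restrict_le_of_bound (μ := μ) (U := U)
          (K := Metric.closedBall (i : P) (r i))
          Metric.isClosed_closedBall (a := fun x => (ψ i x - u x) • pgrad j (χ i) x)
          (b := fun x => ψ i x - u x) (c := L)
          (fun x => by
            rw [norm_smul, mul_comm]
            exact mul_le_mul_of_nonneg_right (hL j hj i x) (norm_nonneg _))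
          (fun x hx => by simp only [hg0 j i x hx, smul_zero])
        rw [hUK] at this
        exact this.trans (by gcongr; exact k0 i)
    · simpa using hN
  refine ⟨fun x => ∑ i, χ i x * ψ i x, ContDiff.sum fun i _ => (hχ i).mul (hψ i), ?_,
    grad j₁ h₁ (Or.inl rfl) hh₁ k1, grad j₂ h₂ (Or.inr rfl) hh₂ k2⟩
  have e : (fun x => (∑ i, χ i x * ψ i x) - u x) =ᵐ[μ.restrict U]
      ∑ i, (fun x => χ i x * (ψ i x - u x)) := by
    filter_upwards [ae_restrict_mem hUm] with x hx
    have s1 := hχsum x (subset_closure hx)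
    rw [Finset.sum_apply]
    simp only [mul_sub, Finset.sum_sub_distrib]
    rw [← Finset.sum_mul, s1, one_mul]
  rw [eLpNorm_congr_ae e]
  refine (eLpNorm_sum_le (fun i _ => (hχ i).continuous.aestronglyMeasurable.mul
    ((hψ i).continuous.aestronglyMeasurable.sub hu.1)) (by norm_num)).trans ?_
  refine (Finset.sum_le_card_nsmul _ _ ε' fun i _ => b0 i).trans (le_trans ?_ hN)
  simp only [Finset.card_univ, Fintype.card_coe, nsmul_eq_mul]
  gcongr
  exact le_mul_of_one_le_left bot_le le_self_add

end Patching

/-! ### Inward translations and the trace on Ω × Γ -/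

theorem exists_translate_mem {d : ℕ} {Ω : Set (E d)} (hΩ : IsBoundedLipschitzDomain Ω) {p : E d}
    (hp : p ∈ closure Ω) : ∃ (r : ℝ) (η : E d) (t₀ : ℝ), 0 < r ∧ 0 < t₀ ∧
      ∀ x ∈ closure Ω ∩ Metric.closedBall p r, ∀ t ∈ Set.Ioo 0 t₀, x + t • η ∈ Ω := by
  by_cases hpΩ : p ∈ Ω
  · obtain ⟨r, hr, h⟩ := Metric.nhds_basis_closedBall.mem_iff.1 (hΩ.isOpen.mem_nhds hpΩ)
    -- Near an interior point no shift is needed.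
    exact ⟨r, 0, 1, hr, one_pos, fun x hx t _ => by simpa using h hx.2⟩
  · have hpf : p ∈ frontier Ω := by
      rw [hΩ.isOpen.frontier_eq]
      exact ⟨hp, hpΩ⟩
    obtain ⟨r, ν, K, g, hr, hν, hg, hinv, h⟩ := hΩ.graph p hpf
    refine ⟨r / 4, ν, r / 2, by positivity, by positivity, fun x hx t ht =>
      add_smul_mem_of_mem_closure hν hg.continuous hinv h hx.1
        (Metric.closedBall_subset_ball (by linarith) hx.2) ht⟩

/-- Pairing the directions of the two factors handles every face and corner of the product, so a
graph description of its boundary is not required. -/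
theorem exists_translate_mem_prod {d : ℕ} {Ω : Set (E d)} (hΩ : IsBoundedLipschitzDomain Ω)
    {p : E d × E d} (hp : p ∈ closure (Ω ×ˢ Ω)) :
    ∃ (r : ℝ) (η : E d × E d) (t₀ : ℝ), 0 < r ∧ 0 < t₀ ∧
      ∀ x ∈ closure (Ω ×ˢ Ω) ∩ Metric.closedBall p r, ∀ t ∈ Set.Ioo 0 t₀,
        x + t • η ∈ Ω ×ˢ Ω := by
  rw [closure_prod_eq] at hp ⊢
  obtain ⟨r₁, η₁, t₁, hr₁, ht₁, h₁⟩ := exists_translate_mem hΩ hp.1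
  obtain ⟨r₂, η₂, t₂, hr₂, ht₂, h₂⟩ := exists_translate_mem hΩ hp.2
  refine ⟨min r₁ r₂, (η₁, η₂), min t₁ t₂, lt_min hr₁ hr₂, lt_min ht₁ ht₂, fun x hx t ht => ?_⟩
  have hb : x.1 ∈ Metric.closedBall p.1 (min r₁ r₂) ∧ x.2 ∈ Metric.closedBall p.2 (min r₁ r₂) := by
    have := hx.2
    rw [← closedBall_prod_same] at this
    exact this
  exact ⟨h₁ x.1 ⟨hx.1.1, Metric.closedBall_subset_closedBall (min_le_left _ _) hb.1⟩ t
      ⟨ht.1, ht.2.trans_le (min_le_left _ _)⟩,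
    h₂ x.2 ⟨hx.1.2, Metric.closedBall_subset_closedBall (min_le_right _ _) hb.2⟩ t
      ⟨ht.1, ht.2.trans_le (min_le_right _ _)⟩⟩

section Trace

variable {d : ℕ} {Ω : Set (E d)}

theorem vol2_eq_restrict (Ω : Set (E d)) :
    vol2 Ω = ((volume : Measure (E d)).prod volume).restrict (Ω ×ˢ Ω) :=
  Measure.prod_restrict Ω Ω

/-- The embedding of the first factor. -/
abbrev inX (d : ℕ) : E d →L[ℝ] E d × E d := ContinuousLinearMap.inl ℝ (E d) (E d)

/-- The embedding of the second factor. -/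
abbrev inY (d : ℕ) : E d →L[ℝ] E d × E d := ContinuousLinearMap.inr ℝ (E d) (E d)

theorem gradient_slice_fst {φ : E d × E d → ℝ} (hφ : ContDiff ℝ 1 φ) (p : E d × E d) :
    gradient (fun x => φ (x, p.2)) p.1 = pgrad (inX d) φ p := by
  have h1 : HasFDerivAt φ (fderiv ℝ φ p) (p.1, p.2) :=
    ((hφ.differentiable (by simp)) p).hasFDerivAt
  have h2 := h1.comp p.1 (hasFDerivAt_prodMk_left (𝕜 := ℝ) p.1 p.2)
  rw [gradient, HasFDerivAt.fderiv (f := fun x => φ (x, p.2)) h2]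
  rfl

theorem gradient_slice_snd {φ : E d × E d → ℝ} (hφ : ContDiff ℝ 1 φ) (p : E d × E d) :
    gradient (fun y => φ (p.1, y)) p.2 = pgrad (inY d) φ p := by
  have h1 : HasFDerivAt φ (fderiv ℝ φ p) (p.1, p.2) :=
    ((hφ.differentiable (by simp)) p).hasFDerivAt
  have h2 := h1.comp p.2 (hasFDerivAt_prodMk_right (𝕜 := ℝ) p.1 p.2)
  rw [gradient, HasFDerivAt.fderiv (f := fun y => φ (p.1, y)) h2]
  rfl

theorem isTrace_iff {G : Triple Ω} {T : Lp ℝ 2 ((vol Ω).prod (surf Ω))} :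
    IsTrace G T ↔ ∃ φ : ℕ → E d × E d → ℝ, (∀ n, ContDiff ℝ 1 (φ n)) ∧
      Tendsto (fun n => eLpNorm (fun p => φ n p - G.val p) 2 (vol2 Ω)) atTop (𝓝 0) ∧
      Tendsto (fun n => eLpNorm (fun p => pgrad (inX d) (φ n) p - G.gradX p) 2 (vol2 Ω)) atTop
        (𝓝 0) ∧
      Tendsto (fun n => eLpNorm (fun p => pgrad (inY d) (φ n) p - G.gradY p) 2 (vol2 Ω)) atTop
        (𝓝 0) ∧
      Tendsto (fun n => eLpNorm (fun p => φ n p - T p) 2 ((vol Ω).prod (surf Ω))) atTop (𝓝 0) := by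
  refine exists_congr fun φ => and_congr_right fun hφ => ?_
  simp only [gradient_slice_fst (hφ _), gradient_slice_snd (hφ _)]

theorem IsH1.exists_approx (hΩ : IsBoundedLipschitzDomain Ω) {G : Triple Ω} (hG : IsH1 G)
    {ε : ENNReal} (hε : 0 < ε) : ∃ ψ : E d × E d → ℝ, ContDiff ℝ 1 ψ ∧
      eLpNorm (fun p => ψ p - G.val p) 2 (vol2 Ω) ≤ ε ∧
      eLpNorm (fun p => pgrad (inX d) ψ p - G.gradX p) 2 (vol2 Ω) ≤ ε ∧
      eLpNorm (fun p => pgrad (inY d) ψ p - G.gradY p) 2 (vol2 Ω) ≤ ε := by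
  have hm0 : MemLp G.val 2 ((volume.prod volume).restrict (Ω ×ˢ Ω)) :=
    vol2_eq_restrict Ω ▸ Lp.memLp G.val
  have hm1 : MemLp G.gradX 2 ((volume.prod volume).restrict (Ω ×ˢ Ω)) :=
    vol2_eq_restrict Ω ▸ Lp.memLp G.gradX
  have hm2 : MemLp G.gradY 2 ((volume.prod volume).restrict (Ω ×ˢ Ω)) :=
    vol2_eq_restrict Ω ▸ Lp.memLp G.gradY
  have hc : IsCompact (closure (Ω ×ˢ Ω)) :=
    (hΩ.isBounded.prod hΩ.isBounded).isCompact_closure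
  have hw1 : IsWeakPGrad (volume.prod volume) (Ω ×ˢ Ω) (inX d) G.val G.gradX := fun φ h1 h2 h3 v => by
    rw [← vol2_eq_restrict]
    exact (hG φ h1 h2 h3 v).1
  have hw2 : IsWeakPGrad (volume.prod volume) (Ω ×ˢ Ω) (inY d) G.val G.gradY := fun φ h1 h2 h3 v => by
    rw [← vol2_eq_restrict]
    exact (hG φ h1 h2 h3 v).2
  obtain ⟨ψ, h, h0, h1, h2⟩ := exists_contDiff_approx (hΩ.isOpen.prod hΩ.isOpen) hc
    (fun p hp => exists_translate_mem_prod hΩ hp) hm0 hm1 hm2 hw1 hw2 hε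
  rw [← vol2_eq_restrict] at h0 h1 h2
  exact ⟨ψ, h.of_le (by simp), h0, h1, h2⟩

end Trace

/-! ### Existence, uniqueness and boundedness of the trace -/

section TraceBound

variable {m : ℕ} {Ω : Set (E (m + 1))}

/-- The trace inequality in y for each fixed x, integrated over x; hence only the y-gradient
appears. -/
theorem exists_trace_bound (hΩ : IsBoundedLipschitzDomain Ω) :
    ∃ C : NNReal, ∀ φ : E (m + 1) × E (m + 1) → ℝ, ContDiff ℝ 1 φ →
      eLpNorm φ 2 ((vol Ω).prod (surf Ω)) ≤
        C * (eLpNorm φ 2 (vol2 Ω) + eLpNorm (pgrad (inY (m + 1)) φ) 2 (vol2 Ω)) := by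
  have := isFiniteMeasure_surf hΩ
  obtain ⟨C, hC⟩ := exists_trace_inequality hΩ
  -- C + 1 replaces √C, since C ≤ (C + 1)².
  refine ⟨C + 1, fun φ hφ => ?_⟩
  have hc := continuous_pgrad (inY (m + 1)) hφ
  have key : eLpNorm φ 2 ((vol Ω).prod (surf Ω)) ^ 2 ≤
      C * (eLpNorm φ 2 (vol2 Ω) ^ 2 + eLpNorm (pgrad (inY (m + 1)) φ) 2 (vol2 Ω) ^ 2) := by
    have ms : ∀ {F : Type} [NormedAddCommGroup F] {f : E (m + 1) × E (m + 1) → F}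
        (ν : Measure (E (m + 1))), Continuous f →
        AEMeasurable (fun p => ‖f p‖ₑ ^ 2) ((vol Ω).prod ν) := fun ν hf =>
      (hf.enorm.measurable.pow_const 2).aemeasurable
    simp only [eLpNorm_two_sq]
    rw [lintegral_prod _ (ms _ hφ.continuous), ← lintegral_add_left' (ms _ hφ.continuous),
      lintegral_prod (fun p => ‖φ p‖ₑ ^ 2 + ‖pgrad (inY (m + 1)) φ p‖ₑ ^ 2)
        ((ms _ hφ.continuous).add (ms _ hc)),
      ← lintegral_const_mul' _ _ ENNReal.coe_ne_top]
    refine lintegral_mono fun x => (hC (fun y => φ (x, y)) (hφ.comp (by fun_prop))).trans ?_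
    have e : ∀ y, gradient (fun y => φ (x, y)) y = pgrad (inY (m + 1)) φ (x, y) := fun y =>
      gradient_slice_snd hφ (x, y)
    simp only [e, le_refl]
  rw [← ENNReal.pow_le_pow_left_iff two_ne_zero]
  refine key.trans ?_
  rw [mul_pow]
  refine mul_le_mul' ?_ ?_
  · rw [ENNReal.coe_add, ENNReal.coe_one, sq]
    calc (C : ENNReal) ≤ (C + 1) * 1 := by rw [mul_one]; exact le_self_add
      _ ≤ _ := mul_le_mul' le_rfl le_add_self
  · rw [add_sq, add_assoc, add_comm (2 * _ * _), ← add_assoc]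
    exact le_self_add

theorem tendsto_add_mul_zero {C : NNReal} {a b : ℕ → ENNReal} (ha : Tendsto a atTop (𝓝 0))
    (hb : Tendsto b atTop (𝓝 0)) : Tendsto (fun n => C * (a n + b n)) atTop (𝓝 0) := by
  have := ENNReal.Tendsto.const_mul (a := (C : ENNReal)) (ha.add hb) (Or.inr (by simp))
  simpa using this

theorem pgrad_combo {d : ℕ} (j : E d →L[ℝ] E d × E d) (a b : ℝ) {φ ψ : E d × E d → ℝ}
    (hφ : ContDiff ℝ 1 φ) (hψ : ContDiff ℝ 1 ψ) (p : E d × E d) :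
    pgrad j (fun p => a • φ p + b • ψ p) p = a • pgrad j φ p + b • pgrad j ψ p := by
  have h1 : DifferentiableAt ℝ φ p := (hφ.differentiable (by simp)) p
  have h2 : DifferentiableAt ℝ ψ p := (hψ.differentiable (by simp)) p
  refine ext_inner_right ℝ fun v => ?_
  simp only [inner_add_left, real_inner_smul_left, inner_pgrad]
  rw [fderiv_fun_add (f := fun p => a • φ p) (g := fun p => b • ψ p) (h1.const_smul a)
    (h2.const_smul b), fderiv_fun_const_smul h1,
    fderiv_fun_const_smul h2]
  rfl

theorem tendsto_eLpNorm_combo {α F : Type*} [MeasurableSpace α] {μ : Measure α}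
    [NormedAddCommGroup F] [NormedSpace ℝ F] (a b : ℝ) {φ ψ : ℕ → α → F} {u v : Lp F 2 μ}
    (hφ : ∀ n, AEStronglyMeasurable (φ n) μ) (hψ : ∀ n, AEStronglyMeasurable (ψ n) μ)
    (l1 : Tendsto (fun n => eLpNorm (fun x => φ n x - u x) 2 μ) atTop (𝓝 0))
    (l2 : Tendsto (fun n => eLpNorm (fun x => ψ n x - v x) 2 μ) atTop (𝓝 0)) :
    Tendsto (fun n => eLpNorm (fun x => (a • φ n x + b • ψ n x) - (a • u + b • v : Lp F 2 μ) x)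
      2 μ) atTop (𝓝 0) := by
  have l : Tendsto (fun n => ‖a‖ₑ * eLpNorm (fun x => φ n x - u x) 2 μ +
      ‖b‖ₑ * eLpNorm (fun x => ψ n x - v x) 2 μ) atTop (𝓝 0) := by
    have := (ENNReal.Tendsto.const_mul (a := ‖a‖ₑ) l1 (Or.inr (by simp))).add
      (ENNReal.Tendsto.const_mul (a := ‖b‖ₑ) l2 (Or.inr (by simp)))
    simpa using this
  refine tendsto_of_tendsto_of_tendsto_of_le_of_le tendsto_const_nhds l (fun _ => bot_le) ?_
  intro n
  have e : (fun x => (a • φ n x + b • ψ n x) - (a • u + b • v : Lp F 2 μ) x) =ᵐ[μ]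
      a • (fun x => φ n x - u x) + b • (fun x => ψ n x - v x) := by
    filter_upwards [Lp.coeFn_add (a • u) (b • v), Lp.coeFn_smul a u, Lp.coeFn_smul b v]
      with x q1 q2 q3
    rw [q1, Pi.add_apply, q2, q3]
    simp only [Pi.add_apply, Pi.smul_apply, smul_sub]
    abel
  simp only [eLpNorm_congr_ae e]
  refine (eLpNorm_add_le (((hφ n).sub (Lp.aestronglyMeasurable u)).const_smul a)
    (((hψ n).sub (Lp.aestronglyMeasurable v)).const_smul b) (by norm_num)).trans ?_
  rw [eLpNorm_const_smul, eLpNorm_const_smul]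
  exact le_rfl

theorem IsTrace.combo {d : ℕ} {Ω : Set (E d)} {G H : Triple Ω}
    {S T : Lp ℝ 2 ((vol Ω).prod (surf Ω))} (hG : IsTrace G S) (hH : IsTrace H T) (a b : ℝ) :
    IsTrace (a • G + b • H) (a • S + b • T) := by
  rw [isTrace_iff] at hG hH ⊢
  obtain ⟨φ, hφ, p0, p1, p2, p3⟩ := hG
  obtain ⟨ψ, hψ, q0, q1, q2, q3⟩ := hH
  refine ⟨fun n p => a • φ n p + b • ψ n p,
    fun n => ((hφ n).const_smul a).add ((hψ n).const_smul b), ?_, ?_, ?_, ?_⟩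
  · exact tendsto_eLpNorm_combo a b (fun n => (hφ n).continuous.aestronglyMeasurable)
      (fun n => (hψ n).continuous.aestronglyMeasurable) p0 q0
  · simp only [fun n p => pgrad_combo (inX d) a b (hφ n) (hψ n) p]
    exact tendsto_eLpNorm_combo a b
      (fun n => (continuous_pgrad (inX d) (hφ n)).aestronglyMeasurable)
      (fun n => (continuous_pgrad (inX d) (hψ n)).aestronglyMeasurable) p1 q1
  · simp only [fun n p => pgrad_combo (inY d) a b (hφ n) (hψ n) p]
    exact tendsto_eLpNorm_combo a b
      (fun n => (continuous_pgrad (inY d) (hφ n)).aestronglyMeasurable)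
      (fun n => (continuous_pgrad (inY d) (hψ n)).aestronglyMeasurable) p2 q2
  · exact tendsto_eLpNorm_combo a b (fun n => (hφ n).continuous.aestronglyMeasurable)
      (fun n => (hψ n).continuous.aestronglyMeasurable) p3 q3

theorem eLpNorm_le_sub_add {α F : Type*} [MeasurableSpace α] {μ : Measure α} [NormedAddCommGroup F]
    {f g : α → F} (hf : AEStronglyMeasurable f μ) (hg : AEStronglyMeasurable g μ) :
    eLpNorm f 2 μ ≤ eLpNorm (fun x => f x - g x) 2 μ + eLpNorm g 2 μ := by
  have := eLpNorm_add_le (p := 2) (hf.sub hg) hg (by norm_num)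
  rwa [sub_add_cancel] at this

/-- The bound for C¹ functions passes to the limit along any sequence defining the trace. -/
theorem exists_trace_norm_le (hΩ : IsBoundedLipschitzDomain Ω) :
    ∃ C : NNReal, ∀ (G : Triple Ω) (T : Lp ℝ 2 ((vol Ω).prod (surf Ω))), IsTrace G T →
      ‖T‖ ≤ C * ‖G‖ := by
  obtain ⟨C, hC⟩ := exists_trace_bound hΩ
  refine ⟨2 * C, fun G T h => ?_⟩
  rw [isTrace_iff] at h
  obtain ⟨φ, hφ, h0, -, h2, h3⟩ := h
  have b : ∀ n, eLpNorm T 2 ((vol Ω).prod (surf Ω)) ≤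
      eLpNorm (fun p => φ n p - T p) 2 ((vol Ω).prod (surf Ω)) +
      (C * (eLpNorm (fun p => φ n p - G.val p) 2 (vol2 Ω) +
        eLpNorm (fun p => pgrad (inY (m + 1)) (φ n) p - G.gradY p) 2 (vol2 Ω)) +
      C * (eLpNorm G.val 2 (vol2 Ω) + eLpNorm G.gradY 2 (vol2 Ω))) := fun n => by
    have k1 := eLpNorm_le_sub_add (Lp.aestronglyMeasurable T)
      ((hφ n).continuous.aestronglyMeasurable (μ := (vol Ω).prod (surf Ω)))
    have k2 := eLpNorm_le_sub_add ((hφ n).continuous.aestronglyMeasurable (μ := vol2 Ω))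
      (Lp.aestronglyMeasurable G.val)
    have k3 := eLpNorm_le_sub_add
      ((continuous_pgrad (inY (m + 1)) (hφ n)).aestronglyMeasurable (μ := vol2 Ω))
      (Lp.aestronglyMeasurable G.gradY)
    have e : eLpNorm (fun p => T p - φ n p) 2 ((vol Ω).prod (surf Ω)) =
        eLpNorm (fun p => φ n p - T p) 2 ((vol Ω).prod (surf Ω)) := eLpNorm_sub_comm _ _ _ _
    rw [e] at k1
    refine k1.trans (add_le_add le_rfl (((hC _ (hφ n)).trans
      (mul_le_mul' le_rfl (add_le_add k2 k3))).trans (le_of_eq ?_)))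
    ring
  have l := h3.add ((tendsto_add_mul_zero (C := C) h0 h2).add
    (tendsto_const_nhds (x := C * (eLpNorm G.val 2 (vol2 Ω) + eLpNorm G.gradY 2 (vol2 Ω)))))
  rw [zero_add, zero_add] at l
  have k := ge_of_tendsto' l b
  have k' : ‖T‖ ≤ C * (‖G.val‖ + ‖G.gradY‖) := by
    rw [Lp.norm_def, Lp.norm_def, Lp.norm_def,
      ← ENNReal.toReal_add (Lp.eLpNorm_ne_top _) (Lp.eLpNorm_ne_top _), ← ENNReal.coe_toReal,
      ← ENNReal.toReal_mul]
    exact ENNReal.toReal_mono (ENNReal.mul_ne_top ENNReal.coe_ne_top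
      (ENNReal.add_ne_top.2 ⟨Lp.eLpNorm_ne_top _, Lp.eLpNorm_ne_top _⟩)) k
  have n1 : ‖G.val‖ ≤ ‖G‖ := WithLp.norm_fst_le _ G
  have n2 : ‖G.gradY‖ ≤ ‖G‖ := (WithLp.norm_snd_le _ G.snd).trans (WithLp.norm_snd_le _ G)
  refine k'.trans ?_
  push_cast
  nlinarith [C.2, mul_le_mul_of_nonneg_left (add_le_add n1 n2) C.2]

theorem IsTrace.unique (hΩ : IsBoundedLipschitzDomain Ω) {G : Triple Ω}
    {S T : Lp ℝ 2 ((vol Ω).prod (surf Ω))} (hS : IsTrace G S) (hT : IsTrace G T) : S = T := by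
  obtain ⟨C, hC⟩ := exists_trace_norm_le hΩ
  have h := hC _ _ (hS.combo hT 1 (-1))
  have e : (1 : ℝ) • G + (-1 : ℝ) • G = 0 := by simp
  rw [e, norm_zero, mul_zero] at h
  have := norm_le_zero_iff.1 h
  rw [one_smul, neg_one_smul, ← sub_eq_add_neg] at this
  exact sub_eq_zero.1 this

/-- Applied to differences, the trace bound makes the restrictions of a smooth approximating
sequence Cauchy in L²(Ω × Γ). -/
theorem IsH1.exists_isTrace (hΩ : IsBoundedLipschitzDomain Ω) {G : Triple Ω} (hG : IsH1 G) :
    ∃ T, IsTrace G T := by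
  obtain ⟨C, hC⟩ := exists_trace_bound hΩ
  choose φ hφ b0 b1 b2 using fun n : ℕ => hG.exists_approx hΩ (ε := (n : ENNReal)⁻¹) (by simp)
  have lim : ∀ {a : ℕ → ENNReal}, (∀ n, a n ≤ (n : ENNReal)⁻¹) → Tendsto a atTop (𝓝 0) := fun h =>
    tendsto_of_tendsto_of_tendsto_of_le_of_le tendsto_const_nhds
      ENNReal.tendsto_inv_nat_nhds_zero (fun _ => bot_le) h
  have s0 : ∀ n, AEStronglyMeasurable (φ n) (vol2 Ω) := fun n =>
    (hφ n).continuous.aestronglyMeasurable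
  have s2 : ∀ n, AEStronglyMeasurable (pgrad (inY (m + 1)) (φ n)) (vol2 Ω) := fun n =>
    (continuous_pgrad _ (hφ n)).aestronglyMeasurable
  have st : ∀ n, AEStronglyMeasurable (φ n) ((vol Ω).prod (surf Ω)) := fun n =>
    (hφ n).continuous.aestronglyMeasurable
  have hdiff : ∀ n k, eLpNorm (fun p => φ n p - φ k p) 2 ((vol Ω).prod (surf Ω)) ≤
      C * (2 * (n : ENNReal)⁻¹ + 2 * (k : ENNReal)⁻¹) := fun n k => by
    have e : (fun p => φ n p - φ k p) = fun p => (1 : ℝ) • φ n p + (-1 : ℝ) • φ k p := by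
      funext p; simp [sub_eq_add_neg]
    rw [e]
    refine (hC _ (((hφ n).const_smul 1).add ((hφ k).const_smul (-1)))).trans ?_
    refine mul_le_mul' le_rfl ?_
    have e2 : pgrad (inY (m + 1)) (fun p => (1 : ℝ) • φ n p + (-1 : ℝ) • φ k p) =
        fun p => pgrad (inY (m + 1)) (φ n) p - pgrad (inY (m + 1)) (φ k) p := by
      funext p
      rw [pgrad_combo _ _ _ (hφ n) (hφ k)]
      simp [sub_eq_add_neg]
    rw [e2, ← e]
    have t0 := eLpNorm_sub_le_add (s0 n) (Lp.aestronglyMeasurable G.val) (s0 k)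
    have t2 := eLpNorm_sub_le_add (s2 n) (Lp.aestronglyMeasurable G.gradY) (s2 k)
    have c0 : eLpNorm (fun p => G.val p - φ k p) 2 (vol2 Ω) ≤ (k : ENNReal)⁻¹ :=
      (eLpNorm_sub_comm _ _ _ _).trans_le (b0 k)
    have c2 : eLpNorm (fun p => G.gradY p - pgrad (inY (m + 1)) (φ k) p) 2 (vol2 Ω) ≤
        (k : ENNReal)⁻¹ := (eLpNorm_sub_comm _ _ _ _).trans_le (b2 k)
    refine (add_le_add (t0.trans (add_le_add (b0 n) c0))
      (t2.trans (add_le_add (b2 n) c2))).trans (le_of_eq ?_)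
    ring
  -- The index is shifted because the tolerance at 0 is ∞, so φ 0 need not be square integrable.
  have hmem : ∀ n, MemLp (φ (n + 1)) 2 ((vol Ω).prod (surf Ω)) := fun n => by
    refine ⟨st _, (hC _ (hφ _)).trans_lt (ENNReal.mul_lt_top ENNReal.coe_lt_top ?_)⟩
    have hi : ((n + 1 : ℕ) : ENNReal)⁻¹ < ⊤ := by simp
    refine ENNReal.add_lt_top.2 ⟨?_, ?_⟩
    · exact (eLpNorm_le_sub_add (s0 _) (Lp.aestronglyMeasurable G.val)).trans_lt
        (ENNReal.add_lt_top.2 ⟨(b0 _).trans_lt hi, Lp.eLpNorm_lt_top _⟩)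
    · exact (eLpNorm_le_sub_add (s2 _) (Lp.aestronglyMeasurable G.gradY)).trans_lt
        (ENNReal.add_lt_top.2 ⟨(b2 _).trans_lt hi, Lp.eLpNorm_lt_top _⟩)
  have hcauchy : CauchySeq fun n => (hmem n).toLp (φ (n + 1)) := by
    refine EMetric.cauchySeq_iff_le_tendsto_0.2
      ⟨fun N => C * (2 * (N : ENNReal)⁻¹ + 2 * (N : ENNReal)⁻¹), fun n k N hn hk => ?_, ?_⟩
    · rw [Lp.edist_toLp_toLp]
      refine (hdiff (n + 1) (k + 1)).trans ?_
      beta_reduce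
      gcongr <;> omega
    · have l : Tendsto (fun N : ℕ => 2 * (N : ENNReal)⁻¹) atTop (𝓝 0) := by
        have := ENNReal.Tendsto.const_mul (a := 2) ENNReal.tendsto_inv_nat_nhds_zero
          (Or.inr (by simp))
        simpa using this
      exact tendsto_add_mul_zero l l
  obtain ⟨T, hT⟩ := cauchySeq_tendsto_of_complete hcauchy
  refine ⟨T, isTrace_iff.2 ⟨fun n => φ (n + 1), fun n => hφ _, ?_, ?_, ?_, ?_⟩⟩
  · exact (lim b0).comp (tendsto_add_atTop_nat 1)
  · exact (lim b1).comp (tendsto_add_atTop_nat 1)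
  · exact (lim b2).comp (tendsto_add_atTop_nat 1)
  · refine ((Lp.tendsto_Lp_iff_tendsto_eLpNorm' _ _).1 hT).congr fun n => eLpNorm_congr_ae ?_
    filter_upwards [(hmem n).coeFn_toLp] with p hp
    rw [Pi.sub_apply, hp]

end TraceBound

/-! ### The abstract Tikhonov problem as least squares -/

section Tikhonov

variable {H Y Z : Type*} [NormedAddCommGroup H] [InnerProductSpace ℝ H] [NormedAddCommGroup Y]
  [InnerProductSpace ℝ Y] [NormedAddCommGroup Z] [InnerProductSpace ℝ Z]

/-- The operator `x ↦ (A x, a x, b S x)`. -/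
noncomputable def tikhonovMap (A : H →L[ℝ] Y) (S : H →L[ℝ] Z) (a b : ℝ) :
    H →L[ℝ] WithLp 2 (Y × WithLp 2 (H × Z)) :=
  (WithLp.prodContinuousLinearEquiv 2 ℝ _ _).symm.toContinuousLinearMap ∘L A.prod
    ((WithLp.prodContinuousLinearEquiv 2 ℝ _ _).symm.toContinuousLinearMap ∘L
      (a • ContinuousLinearMap.id ℝ H).prod (b • S))

/-- The Tikhonov functional `‖A x - u‖² + α (‖x‖² + γ ‖S x‖²)`. -/
def tikhonov (A : H →L[ℝ] Y) (S : H →L[ℝ] Z) (α γ : ℝ) (u : Y) (x : H) : ℝ :=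
  ‖A x - u‖ ^ 2 + α * (‖x‖ ^ 2 + γ * ‖S x‖ ^ 2)

variable {A : H →L[ℝ] Y} {S : H →L[ℝ] Z} {α γ : ℝ}

theorem norm_tikhonovMap_sub_sq (hα : 0 < α) (hγ : 0 < γ) (u : Y) (x : H) :
    ‖tikhonovMap A S √α √(α * γ) x - WithLp.toLp 2 (u, 0)‖ ^ 2 = tikhonov A S α γ u x := by
  rw [WithLp.prod_norm_sq_eq_of_L2, WithLp.prod_norm_sq_eq_of_L2]
  have e1 : (tikhonovMap A S √α √(α * γ) x - WithLp.toLp 2 (u, 0)).fst = A x - u := rfl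
  have e2 : (tikhonovMap A S √α √(α * γ) x - WithLp.toLp 2 (u, 0)).snd.fst = √α • x :=
    sub_zero (√α • x)
  have e3 : (tikhonovMap A S √α √(α * γ) x - WithLp.toLp 2 (u, 0)).snd.snd = √(α * γ) • S x :=
    sub_zero (√(α * γ) • S x)
  rw [e1, e2, e3, norm_smul, norm_smul, mul_pow, mul_pow, Real.norm_eq_abs,
    Real.norm_eq_abs, sq_abs, sq_abs, Real.sq_sqrt hα.le, Real.sq_sqrt (mul_pos hα hγ).le, tikhonov]
  ring

theorem mul_norm_le_norm_tikhonovMap {a b : ℝ} (ha : 0 ≤ a) (x : H) :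
    a * ‖x‖ ≤ ‖tikhonovMap A S a b x‖ := by
  have h : ‖a • x‖ ≤ ‖tikhonovMap A S a b x‖ :=
    (WithLp.norm_fst_le _ (tikhonovMap A S a b x).snd).trans (WithLp.norm_snd_le _ _)
  rwa [norm_smul, Real.norm_of_nonneg ha] at h

theorem tikhonov_le_iff (hα : 0 < α) (hγ : 0 < γ) {u : Y} {x y : H} :
    tikhonov A S α γ u x ≤ tikhonov A S α γ u y ↔
      ‖tikhonovMap A S √α √(α * γ) x - WithLp.toLp 2 (u, 0)‖ ≤
        ‖tikhonovMap A S √α √(α * γ) y - WithLp.toLp 2 (u, 0)‖ := by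
  rw [← norm_tikhonovMap_sub_sq hα hγ, ← norm_tikhonovMap_sub_sq hα hγ,
    sq_le_sq₀ (norm_nonneg _) (norm_nonneg _)]

theorem exists_tikhonov_minimizer [CompleteSpace H] (hα : 0 < α) (hγ : 0 < γ) (u : Y) :
    ∃ x, ∀ y, tikhonov A S α γ u x ≤ tikhonov A S α γ u y := by
  simp only [tikhonov_le_iff hα hγ]
  exact exists_forall_norm_sub_le _ (Real.sqrt_pos.2 hα)
    (mul_norm_le_norm_tikhonovMap (Real.sqrt_nonneg α)) _

/-- The least-squares stability estimate with lower bound √α; the targets (u, 0) and (u', 0) are as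
far apart as u and u'. -/
theorem tikhonov_stability (hα : 0 < α) (hγ : 0 < γ) {u u' : Y} {x x' : H}
    (h : ∀ y, tikhonov A S α γ u x ≤ tikhonov A S α γ u y)
    (h' : ∀ y, tikhonov A S α γ u' x' ≤ tikhonov A S α γ u' y) :
    √α * ‖x - x'‖ ≤ ‖u - u'‖ := by
  simp only [tikhonov_le_iff hα hγ] at h h'
  refine (norm_sub_le_of_minimizers _ (mul_norm_le_norm_tikhonovMap (Real.sqrt_nonneg α))
    h h').trans (le_of_eq ?_)
  rw [← sq_eq_sq₀ (norm_nonneg _) (norm_nonneg _), WithLp.prod_norm_sq_eq_of_L2]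
  change ‖u - u'‖ ^ 2 + ‖(0 : WithLp 2 (H × Z)) - 0‖ ^ 2 = _
  simp

end Tikhonov

/-! ### The forward operator and the functional J -/

section Forward

variable {m : ℕ} {Ω : Set (E (m + 1))}

theorem isTrace_trace (hΩ : IsBoundedLipschitzDomain Ω) (G : X Ω) : IsTrace G.1 (trace G.1) := by
  have h := G.2.1.exists_isTrace hΩ
  rw [trace, dif_pos h]
  exact h.choose_spec

/-- The trace as a linear map on `X`. -/
noncomputable def traceₗ (hΩ : IsBoundedLipschitzDomain Ω) :
    X Ω →ₗ[ℝ] Lp ℝ 2 ((vol Ω).prod (surf Ω)) where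
  toFun G := trace G.1
  map_add' G H := by
    -- The trace is defined by choice; uniqueness is what makes it linear.
    have h := (isTrace_trace hΩ G).combo (isTrace_trace hΩ H) 1 1
    simp only [one_smul] at h
    exact (isTrace_trace hΩ (G + H)).unique hΩ h
  map_smul' c G := by
    have h := (isTrace_trace hΩ G).combo (isTrace_trace hΩ G) c 0
    simp only [zero_smul, add_zero] at h
    exact (isTrace_trace hΩ (c • G)).unique hΩ h

theorem exists_traceL (hΩ : IsBoundedLipschitzDomain Ω) :
    ∃ L : X Ω →L[ℝ] Lp ℝ 2 ((vol Ω).prod (surf Ω)), ∀ G : X Ω, L G = trace G.1 := by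
  obtain ⟨C, hC⟩ := exists_trace_norm_le hΩ
  exact ⟨(traceₗ hΩ).mkContinuous C fun G => hC _ _ (isTrace_trace hΩ G), fun _ => rfl⟩

/-- The bounded trace followed by integration against f₁, plus integration of G against f₂. The
equality is almost everywhere because `forward` is a pointwise function. -/
theorem exists_forwardL (hΩ : IsBoundedLipschitzDomain Ω) (f₁ : Lp ℝ 2 (surf Ω))
    (f₂ : Lp ℝ 2 (vol Ω)) :
    ∃ A : X Ω →L[ℝ] Y Ω, ∀ G : X Ω, forward f₁ f₂ G =ᵐ[vol Ω] A G := by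
  have := isFiniteMeasure_surf hΩ
  obtain ⟨L, hL⟩ := exists_traceL hΩ
  refine ⟨sliceIntegral (vol Ω) f₁ ∘L L +
    sliceIntegral (vol Ω) f₂ ∘L WithLp.fstL 2 ℝ _ _ ∘L (X Ω).subtypeL, fun G => ?_⟩
  have h1 := coeFn_sliceIntegral (μ := vol Ω) f₁ (L G)
  have h2 := coeFn_sliceIntegral (μ := vol Ω) f₂ G.1.val
  have h3 := Lp.coeFn_add (sliceIntegral (vol Ω) f₁ (L G)) (sliceIntegral (vol Ω) f₂ G.1.val)
  rw [hL] at h1 h3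
  filter_upwards [h1, h2, h3] with x e1 e2 e3
  change _ = (sliceIntegral (vol Ω) f₁ (L G) + sliceIntegral (vol Ω) f₂ G.1.val : Lp ℝ 2 (vol Ω)) x
  rw [hL, e3, Pi.add_apply, e1, e2]
  rfl

/-- The operator `G ↦ G - Gᵀ` on `L²(Ω×Ω)`. -/
noncomputable def subSwap (Ω : Set (E (m + 1))) : Lp ℝ 2 (vol2 Ω) →L[ℝ] Lp ℝ 2 (vol2 Ω) :=
  ContinuousLinearMap.id ℝ _ - (Lp.compMeasurePreservingₗᵢ ℝ Prod.swap
    (Measure.measurePreserving_swap (μ := vol Ω) (ν := vol Ω))).toContinuousLinearMap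

theorem norm_subSwap_sq (f : Lp ℝ 2 (vol2 Ω)) :
    ‖subSwap Ω f‖ ^ 2 = ∫ p, (f p - f p.swap) ^ 2 ∂(vol2 Ω) := by
  rw [← real_inner_self_eq_norm_sq, L2.inner_def]
  have hmp := Measure.measurePreserving_swap (μ := vol Ω) (ν := vol Ω)
  have h1 := Lp.coeFn_sub f (Lp.compMeasurePreserving Prod.swap hmp f)
  have h2 := Lp.coeFn_compMeasurePreserving f hmp
  refine integral_congr_ae ?_
  filter_upwards [h1, h2] with p e1 e2
  have e : (subSwap Ω f : E (m + 1) × E (m + 1) → ℝ) p = f p - f p.swap := by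
    change (f - Lp.compMeasurePreserving Prod.swap hmp f : Lp ℝ 2 (vol2 Ω)) p = _
    rw [e1, Pi.sub_apply, e2]
    rfl
  rw [e, real_inner_self_eq_norm_sq, Real.norm_eq_abs, sq_abs]

/-- The operator `G ↦ G - Gᵀ` from `X` to `L²(Ω×Ω)`. -/
noncomputable def subTranspose (Ω : Set (E (m + 1))) : X Ω →L[ℝ] Lp ℝ 2 (vol2 Ω) :=
  subSwap Ω ∘L WithLp.fstL 2 ℝ _ _ ∘L (X Ω).subtypeL

theorem J_eq_tikhonov {f₁ : Lp ℝ 2 (surf Ω)} {f₂ : Lp ℝ 2 (vol Ω)} {A : X Ω →L[ℝ] Y Ω} {α γ : ℝ}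
    (hA : ∀ G : X Ω, forward f₁ f₂ G =ᵐ[vol Ω] A G) (u : Y Ω) (G : X Ω) :
    J f₁ f₂ α γ u G = tikhonov A (subTranspose Ω) α γ u G := by
  have e : ‖subTranspose Ω G‖ ^ 2 = ∫ p, (G.1.val p - G.1.val p.swap) ^ 2 ∂(vol2 Ω) :=
    norm_subSwap_sq G.1.val
  have e' : (eLpNorm (fun x => forward f₁ f₂ G x - u x) 2 (vol Ω)).toReal = ‖A G - u‖ := by
    refine (congrArg ENNReal.toReal (eLpNorm_congr_ae ?_)).trans (Lp.norm_def (A G - u)).symm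
    filter_upwards [hA G, Lp.coeFn_sub (A G) u] with x h1 h2
    rw [h1, h2, Pi.sub_apply]
  exact congrArg₂ (fun a b => a ^ 2 + α * (‖G‖ ^ 2 + γ * b)) e' e.symm

theorem IsMinimizer.norm_sub_le (hΩ : IsBoundedLipschitzDomain Ω) {f₁ : Lp ℝ 2 (surf Ω)}
    {f₂ : Lp ℝ 2 (vol Ω)} {α γ : ℝ} (hα : 0 < α) (hγ : 0 < γ) {u u' : Y Ω} {G G' : X Ω}
    (h : IsMinimizer f₁ f₂ α γ u G) (h' : IsMinimizer f₁ f₂ α γ u' G') :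
    √α * ‖G - G'‖ ≤ ‖u - u'‖ := by
  obtain ⟨A, hA⟩ := exists_forwardL hΩ f₁ f₂
  simp only [IsMinimizer, J_eq_tikhonov hA] at h h'
  exact tikhonov_stability hα hγ h h'

theorem exists_isMinimizer (hΩ : IsBoundedLipschitzDomain Ω) (f₁ : Lp ℝ 2 (surf Ω))
    (f₂ : Lp ℝ 2 (vol Ω)) {α γ : ℝ} (hα : 0 < α) (hγ : 0 < γ) (u : Y Ω) :
    ∃ G : X Ω, IsMinimizer f₁ f₂ α γ u G := by
  obtain ⟨A, hA⟩ := exists_forwardL hΩ f₁ f₂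
  have := completeSpace_X (Ω := Ω)
  simp only [IsMinimizer, J_eq_tikhonov hA]
  exact exists_tikhonov_minimizer hα hγ u

theorem IsMinimizer.tendsto (hΩ : IsBoundedLipschitzDomain Ω) {f₁ : Lp ℝ 2 (surf Ω)}
    {f₂ : Lp ℝ 2 (vol Ω)} {α γ : ℝ} (hα : 0 < α) (hγ : 0 < γ) {u' : Y Ω} {u : ℕ → Y Ω}
    (hu : Tendsto u atTop (𝓝 u')) {G' : X Ω} {G : ℕ → X Ω} (h' : IsMinimizer f₁ f₂ α γ u' G')
    (h : ∀ n, IsMinimizer f₁ f₂ α γ (u n) (G n)) : Tendsto G atTop (𝓝 G') := by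
  rw [tendsto_iff_norm_sub_tendsto_zero] at hu ⊢
  have hs := Real.sqrt_pos.2 hα
  have l := hu.const_mul (√α)⁻¹
  rw [mul_zero] at l
  refine squeeze_zero (fun _ => norm_nonneg _) (fun n => ?_) l
  rw [← div_eq_inv_mul, le_div_iff₀' hs]
  exact (h n).norm_sub_le hΩ hα hγ h'

end Forward

end GreenTikhonov

open GreenTikhonov in
/-- Well-posedness of the Tikhonov-regularized problem: the forward operator is well defined from
`X` to `L²(Ω)`; for all data the functional has exactly one minimizer; and minimizers converge in
`X` when the data converge in `L²(Ω)`. -/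
theorem mainTheorem1 (d : ℕ) (hd : d = 2 ∨ d = 3) (Ω : Set (E d))
    (hΩ : IsBoundedLipschitzDomain Ω) (f₁ : Lp ℝ 2 (surf Ω)) (f₂ : Lp ℝ 2 (vol Ω))
    (α γ : ℝ) (hα : 0 < α) (hγ : 0 < γ) :
    (∀ G : X Ω, (∃! T, IsTrace G.1 T) ∧
      (∀ᵐ x ∂(vol Ω), Integrable (fun y => trace G.1 (x, y) * f₁ y) (surf Ω) ∧
        Integrable (fun y => G.1.val (x, y) * f₂ y) (vol Ω)) ∧
      MemLp (forward f₁ f₂ G) 2 (vol Ω)) ∧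
    (∀ u_obs : Y Ω, ∃ G : X Ω, IsMinimizer f₁ f₂ α γ u_obs G) ∧
    (∀ (u_obs : Y Ω) (G₁ G₂ : X Ω), IsMinimizer f₁ f₂ α γ u_obs G₁ →
      IsMinimizer f₁ f₂ α γ u_obs G₂ → G₁ = G₂) ∧
    (∀ (u_obs : Y Ω) (u : ℕ → Y Ω), Tendsto u atTop (𝓝 u_obs) →
      ∀ (G' : X Ω) (G : ℕ → X Ω), IsMinimizer f₁ f₂ α γ u_obs G' →
        (∀ n, IsMinimizer f₁ f₂ α γ (u n) (G n)) → Tendsto G atTop (𝓝 G')) := by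
  -- Writing d = m + 1 makes the boundary dimension d − 1 equal to m.
  obtain ⟨m, rfl⟩ : ∃ m, d = m + 1 := ⟨d - 1, by omega⟩
  have := isFiniteMeasure_surf hΩ
  refine ⟨fun G => ⟨⟨trace G.1, isTrace_trace hΩ G, fun T hT => hT.unique hΩ (isTrace_trace hΩ G)⟩,
    ?_, ?_⟩, exists_isMinimizer hΩ f₁ f₂ hα hγ, fun u G₁ G₂ h₁ h₂ => ?_,
    fun u' u hu G' G h' h => IsMinimizer.tendsto hΩ hα hγ hu h' h⟩
  · filter_upwards [integrable_slice_mul (Lp.memLp (trace G.1)) (Lp.memLp f₁),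
      integrable_slice_mul (Lp.memLp G.1.val) (Lp.memLp f₂)] with x h1 h2
    exact ⟨h1, h2⟩
  · obtain ⟨A, hA⟩ := exists_forwardL hΩ f₁ f₂
    exact (Lp.memLp (A G)).ae_eq (hA G).symm
  -- Uniqueness is stability for constant data: the constant sequence G₁ converges to G₂.
  · exact tendsto_nhds_unique (tendsto_const_nhds (x := G₁) (f := atTop (α := ℕ)))
      (IsMinimizer.tendsto hΩ hα hγ (tendsto_const_nhds (x := u)) h₂ fun _ => h₁)
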